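/- **Conventions.** A growth function is a non-decreasing $\Phi:[0,\infty)\to[0,\infty)$ with $\lim_{t\to0}\Phi(t)=\Phi(0)=0$, $\Phi(t)>0$ for $t>0$ and $\lim_{t\to\infty}\Phi(t)=\infty$. Let $\mathscr U$ be the set of convex growth functions $\Phi$, continuously differentiable on $(0,\infty)$, such that $t\mapsto\Phi(t)/t$ is non-decreasing on $(0,\infty)$ and, for some $p\ge1$ and $C>1$, $\Phi(st)\le Ct^p\Phi(s)$ for all $t\ge1$, $s\ge0$. Let $\mathscr L$ be the set of concave growth functions $\Phi$, continuously differentiable on $(0,\infty)$, such that $t\mapsto\Phi(t)/t$ is non-increasing on $(0,\infty)$ and, for some $0<p\le1$ and $C>1$, $\Phi(st)\le Ct^p\Phi(s)$ for all $0\le t\le1$, $s\ge0$. The complementary function of $\Phi$ is $s\mapsto\sup_{t\ge0}\{st-\Phi(t)\}\in[0,\infty]$, $s\ge0$. $\Phi\in\Delta_2$ means that for some $K>1$, $\Phi(2t)\le K\Phi(t)$ for all $t>0$; a convex $\Phi$ is in $\nabla_2$ if $\Phi$ and its complementary function both satisfy $\Delta_2$. For a measure space $(X,\mu)$, $L^\Phi(X,d\mu)$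 is the space of ($\mu$-classes of) measurable $f:X\to\mathbb C$ with $$\|f\|_{L^\Phi_\mu}=\inf\Big\{\lambda>0:\int_X\Phi(|f|/\lambda)\,d\mu\le1\Big\}<\infty .$$ Let $\mathbb C_+=\{z\in\mathbb C:\operatorname{Im}z>0\}$ and $dV_\alpha(x+iy)=y^\alpha\,dx\,dy$. The Bergman–Orlicz space $A^\Phi_\alpha(\mathbb C_+)$ is the space of analytic functions on $\mathbb C_+$ that belong to $L^\Phi(\mathbb C_+,dV_\alpha)$, with $\|F\|_{A^\Phi_\alpha}=\|F\|_{L^\Phi_{V_\alpha}}$. The Berezin transform of a positive Borel measure $\mu$ on $\mathbb C_+$ is $$\widetilde\mu(z)=\int_{\mathbb C_+}\frac{(\operatorname{Im}z)^{2+\alpha}}{|\omega-\overline z|^{2(2+\alpha)}}\,d\mu(\omega),\qquad z\in\mathbb C_+ .$$ **Theorem.** Let $\alpha>-1$, let $\Phi_1\in\mathscr U\cap\nabla_2$, $\Phi_2\in\mathscr L\cup\mathscr U$, and let $\mu$ be a positive Borel measure on $\mathbb C_+$. Suppose that $t\mapsto\Phi_1(t)/\Phi_2(t)$ is non-decreasing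 on $(0,\infty)$ and that there is a constant $C>0$ with $$\int_0^t\frac{\Phi_1\circ\Phi_2^{-1}(s)}{s^2}\,ds\le C\,\frac{\Phi_1\circ\Phi_2^{-1}(t)}{t}\qquad\text{for all }t>0 .$$ Then the following assertions are equivalent. (i) $A^{\Phi_1}_\alpha(\mathbb C_+)$ embeds continuously into $L^{\Phi_2}(\mathbb C_+,d\mu)$: there is a constant $C>0$ such that every $F\in A^{\Phi_1}_\alpha(\mathbb C_+)$ satisfies $F\in L^{\Phi_2}(\mathbb C_+,d\mu)$ and $\|F\|_{L^{\Phi_2}_\mu}\le C\,\|F\|_{A^{\Phi_1}_\alpha}$. (ii) The Berezin transform $\widetilde\mu$ is finite almost everywhere and belongs to $L^{\Phi_3}(\mathbb C_+,dV_\alpha)$, where $\Phi_3$ is the complementary function of $\Phi_1\circ\Phi_2^{-1}$. -/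

import Mathlib

open Set Filter Topology MeasureTheory UpperHalfPlane
open scoped ENNReal

noncomputable section

namespace BergmanOrlicz

/-! ### Growth functions

A function on `[0, ∞)` is represented by a function `ℝ → ℝ`; only its values on `[0, ∞)` matter. -/

/-- Growth functions `[0, ∞) → [0, ∞)`: non-decreasing, `Φ(t) → Φ(0) = 0` as `t → 0`, positive on
`(0, ∞)`, and tending to infinity. -/
structure IsGrowthFunction (Φ : ℝ → ℝ) : Prop where
  monotoneOn : MonotoneOn Φ (Ici 0)
  map_zero : Φ 0 = 0
  tendsto_zero : Tendsto Φ (𝓝[>] 0) (𝓝 0)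
  pos : ∀ t : ℝ, 0 < t → 0 < Φ t
  tendsto_atTop : Tendsto Φ atTop atTop

/-- `Φ` is of upper type `p`. -/
def IsUpperType (Φ : ℝ → ℝ) (p : ℝ) : Prop :=
  ∃ C : ℝ, 1 < C ∧ ∀ t s : ℝ, 1 ≤ t → 0 ≤ s → Φ (s * t) ≤ C * t ^ p * Φ s

/-- `Φ` is of lower type `p`. -/
def IsLowerType (Φ : ℝ → ℝ) (p : ℝ) : Prop :=
  ∃ C : ℝ, 1 < C ∧ ∀ t s : ℝ, 0 ≤ t → t ≤ 1 → 0 ≤ s → Φ (s * t) ≤ C * t ^ p * Φ s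

/-- The class `𝒰`: growth functions of some upper type `p ≥ 1` with `Φ(t)/t` non-decreasing on
`(0, ∞)`, normalized to be convex and continuously differentiable. -/
structure ClassU (Φ : ℝ → ℝ) : Prop where
  growth : IsGrowthFunction Φ
  upperType : ∃ p : ℝ, 1 ≤ p ∧ IsUpperType Φ p
  monotoneOn_div : MonotoneOn (fun t => Φ t / t) (Ioi 0)
  contDiffOn : ContDiffOn ℝ 1 Φ (Ioi 0)
  convexOn : ConvexOn ℝ (Ici 0) Φ

/-- The class `ℒ`: growth functions of some lower type `0 < p ≤ 1` with `Φ(t)/t` non-increasing on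
`(0, ∞)`, normalized to be concave and continuously differentiable on `(0, ∞)` (differentiability
at `0` is not demanded, so that the powers `t ^ p` with `0 < p ≤ 1` belong to the class). -/
structure ClassL (Φ : ℝ → ℝ) : Prop where
  growth : IsGrowthFunction Φ
  lowerType : ∃ p : ℝ, 0 < p ∧ p ≤ 1 ∧ IsLowerType Φ p
  antitoneOn_div : AntitoneOn (fun t => Φ t / t) (Ioi 0)
  contDiffOn : ContDiffOn ℝ 1 Φ (Ioi 0)
  concaveOn : ConcaveOn ℝ (Ici 0) Φ

/-- A real function on `[0, ∞)` seen as a function with values in `[0, ∞]`. -/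
def toENN (Φ : ℝ → ℝ) (t : ℝ) : ℝ≥0∞ := ENNReal.ofReal (Φ t)

/-- The complementary function `s ↦ sup_{t ≥ 0} (s t - Φ(t))`, with values in `[0, ∞]`. The
truncation at `0` made by `ENNReal.ofReal` does not change the supremum when `Φ(0) = 0`. -/
def complementary (Φ : ℝ → ℝ) (s : ℝ) : ℝ≥0∞ :=
  ⨆ t ∈ Ici (0 : ℝ), ENNReal.ofReal (s * t - Φ t)

/-- The `Δ₂`-condition. -/
def Delta2 (Φ : ℝ → ℝ≥0∞) : Prop :=
  ∃ K : ℝ, 1 < K ∧ ∀ t : ℝ, 0 < t → Φ (2 * t) ≤ ENNReal.ofReal K * Φ t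

/-- The `∇₂`-condition for a convex growth function: the function and its complementary function
both satisfy the `Δ₂`-condition. -/
def Nabla2 (Φ : ℝ → ℝ) : Prop :=
  Delta2 (toENN Φ) ∧ Delta2 (complementary Φ)

/-- The inverse `Φ⁻¹ : [0, ∞) → [0, ∞)` of a bijection `Φ` of `[0, ∞)`. -/
def inverse (Φ : ℝ → ℝ) : ℝ → ℝ := Function.invFunOn Φ (Ici 0)

/-! ### Orlicz spaces -/

/-- The Luxemburg (quasi-)norm `inf {r > 0 : ∫ Φ(|f|/r) dμ ≤ 1}`, equal to `∞` if there is no such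
`r`. -/
def luxNorm {X : Type*} [MeasurableSpace X] (Φ : ℝ → ℝ≥0∞) (μ : Measure X) (f : X → ℂ) : ℝ≥0∞ :=
  ⨅ (r : ℝ) (_ : 0 < r) (_ : ∫⁻ x, Φ (‖f x‖ / r) ∂μ ≤ 1), ENNReal.ofReal r

/-- `f` belongs to the Orlicz space `L^Φ(X, dμ)`. -/
def MemOrlicz {X : Type*} [MeasurableSpace X] (Φ : ℝ → ℝ≥0∞) (μ : Measure X) (f : X → ℂ) : Prop :=
  AEStronglyMeasurable f μ ∧ luxNorm Φ μ f < ∞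

/-! ### The upper half-plane -/


/-- The measure `dV_α = (Im z)^α dx dy` on `ℂ₊`. -/
def V (α : ℝ) : Measure ℂ :=
  (volume.restrict upperHalfPlaneSet).withDensity fun z => ENNReal.ofReal (z.im ^ α)

/-- The Bergman-Orlicz space `A^Φ_α(ℂ₊)`: the analytic functions on `ℂ₊` in `L^Φ(ℂ₊, dV_α)`. -/
def bergmanOrlicz (α : ℝ) (Φ : ℝ → ℝ) : Set (ℂ → ℂ) :=
  {F | DifferentiableOn ℂ F upperHalfPlaneSet ∧ MemOrlicz (toENN Φ) (V α) F}

/-- The Berezin transform `z ↦ ∫ (Im z)^(2+α) / |ω - z̄|^(2(2+α)) dμ(ω)`, with values in `[0, ∞]`. -/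
def berezin (α : ℝ) (μ : Measure ℂ) (z : ℂ) : ℝ≥0∞ :=
  ∫⁻ ω, ENNReal.ofReal
    (z.im ^ (2 + α) / ‖ω - (starRingEnd ℂ) z‖ ^ (2 * (2 + α))) ∂μ

end BergmanOrlicz

end

/-!
The embedding theorem is reduced to a discrete statement on a Whitney decomposition of the upper
half-plane into dyadic squares `Q` ("tiles"), on which all quantities involved are essentially
constant. Write `Ψ = Φ₁ ∘ Φ₂⁻¹`; it is of upper type and `Ψ(t)/t` is non-decreasing, but it need
not be convex, and its complementary function is only used through its definition as a supremum.

The analytic tool is `IsYoungType.exists_modular_bound`: the positive integral operator with kernel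
`v^(b-2-α) / |z - w̄|^b`, `v = Im w`, `b > α + 2`, satisfies `∫ Φ(T m) dV ≤ C ∫ Φ(m) dV` for every
such function, `Φ₁` and `Ψ` alike. Jensen's inequality is replaced by
`IsYoungType.map_half_le_lintegral`, which does without convexity.

If the Berezin transform of `μ` belongs to the space, then for `F` of modular at most `1` the mean
value inequality on a tile bounds `Φ₁(|F(w)|)` by `J(z)`, where `J` majorizes `Φ₁(T|F|)` up to
constants. Young's inequality for `Ψ` and its complementary function, applied to `Φ₂(|F(w)|)` and
the Berezin transform at `z`, then gives a bound for `∫_Q Φ₂(|F|) dμ` which can be summed over `Q`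
(`exists_modular_embedding`).

Conversely, the embedding is tested on sums `∑ ± a_Q (v_Q / (z - w̄_Q))^n` of powers of kernels
centred at corners `w_Q` of tiles. Averaging over the signs isolates the single terms
(`card_mul_le_sum_signs`), so that `∑ s_Q μ(Q)` is bounded as soon as `∑ Ψ(s_Q) V(Q)` is small
(`exists_tile_bound`). The modular inequality for `Ψ` carries this over to the adjoint of the
Berezin transform (`exists_sum_berezin_le`), and a scaling argument turns the bounded functional so
obtained into a bound for the modular of the complementary function
(`IsYoungType.sum_complementary_le`).
-/

namespace BergmanOrlicz

/-! ### Growth functions of upper type -/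

/-- The properties shared by `Φ₁` and `Φ₁ ∘ Φ₂⁻¹` on which the estimates rest: a non-decreasing
function on `[0, ∞)` vanishing at `0`, of some upper type, with `Φ(t)/t` non-decreasing. Convexity
is not demanded, since `Φ₁ ∘ Φ₂⁻¹` need not be convex. -/
structure IsYoungType (Φ : ℝ → ℝ) : Prop where
  map_zero : Φ 0 = 0
  monotoneOn : MonotoneOn Φ (Ici 0)
  monotoneOn_div : MonotoneOn (fun t => Φ t / t) (Ioi 0)
  upperType : ∃ p : ℝ, 1 ≤ p ∧ IsUpperType Φ p

namespace IsYoungType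

variable {Φ : ℝ → ℝ} (h : IsYoungType Φ)
include h

lemma nonneg {t : ℝ} (ht : 0 ≤ t) : 0 ≤ Φ t :=
  h.map_zero ▸ h.monotoneOn self_mem_Ici ht ht

lemma map_mul_le {θ t : ℝ} (hθ : 0 ≤ θ) (hθ1 : θ ≤ 1) (ht : 0 ≤ t) : Φ (θ * t) ≤ θ * Φ t := by
  rcases hθ.eq_or_lt with rfl | hθ
  · simp [h.map_zero]
  rcases ht.eq_or_lt with rfl | ht
  · simp [h.map_zero]
  have h1 := h.monotoneOn_div (mul_pos hθ ht) ht (by nlinarith)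
  simp only at h1
  rw [div_le_div_iff₀ (mul_pos hθ ht) ht] at h1
  nlinarith

lemma exists_map_mul_le : ∃ p C : ℝ, 1 ≤ p ∧ 1 ≤ C ∧
    ∀ θ t : ℝ, 0 ≤ θ → 0 ≤ t → Φ (θ * t) ≤ C * (θ + θ ^ p) * Φ t := by
  obtain ⟨p, hp, C, hC, hΦ⟩ := h.upperType
  refine ⟨p, C, hp, hC.le, fun θ t hθ ht => ?_⟩
  have h0 := h.nonneg ht
  have hpow : 0 ≤ θ ^ p := Real.rpow_nonneg hθ p
  rcases le_total θ 1 with h1 | h1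
  · refine (h.map_mul_le hθ h1 ht).trans (mul_le_mul_of_nonneg_right ?_ h0)
    nlinarith
  · rw [mul_comm θ t]
    refine (hΦ θ t h1 ht).trans (mul_le_mul_of_nonneg_right ?_ h0)
    nlinarith

lemma exists_map_mul_le_const (A : ℝ) (hA : 0 ≤ A) :
    ∃ C : ℝ, 0 < C ∧ ∀ t : ℝ, 0 ≤ t → Φ (A * t) ≤ C * Φ t := by
  obtain ⟨p, C, hp, hC, hΦ⟩ := h.exists_map_mul_le
  refine ⟨C * (A + A ^ p) + 1, by positivity, fun t ht => (hΦ A t hA ht).trans ?_⟩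
  have := h.nonneg ht
  nlinarith

lemma exists_pos_map_le (δ : ℝ) (hδ : 0 < δ) : ∃ t : ℝ, 0 < t ∧ Φ t ≤ δ := by
  have h1 := h.nonneg zero_le_one
  refine ⟨min 1 (δ / (Φ 1 + 1)), by positivity, ?_⟩
  have h2 := h.map_mul_le (θ := min 1 (δ / (Φ 1 + 1))) (by positivity) (min_le_left _ _)
    zero_le_one
  rw [mul_one] at h2
  refine h2.trans ((mul_le_mul_of_nonneg_right (min_le_right _ _) h1).trans ?_)
  rw [div_mul_eq_mul_div, div_le_iff₀ (by positivity)]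
  nlinarith

end IsYoungType

lemma measurable_comp_of_monotoneOn {X : Type*} [MeasurableSpace X] {Φ : ℝ → ℝ}
    (hΦ : MonotoneOn Φ (Ici 0)) {m : X → ℝ} (hm : Measurable m) (h0 : ∀ x, 0 ≤ m x) :
    Measurable fun x => Φ (m x) := by
  have h1 : Monotone fun t => Φ (max t 0) := fun a b hab =>
    hΦ (mem_Ici.2 (le_max_right _ _)) (mem_Ici.2 (le_max_right _ _)) (max_le_max_right 0 hab)
  have h2 : (fun x => Φ (m x)) = (fun t => Φ (max t 0)) ∘ m := by
    ext x; simp [max_eq_left (h0 x)]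
  rw [h2]
  exact h1.measurable.comp hm

/-- A substitute for Jensen's inequality which only uses that `Φ(t)/t` is non-decreasing: the part
of the mean coming from the values of `m` below `t/2` is at most `t/2`, and on the rest
`Φ(t/2)/(t/2) * m ≤ Φ(m)`. -/
lemma IsYoungType.map_half_le_lintegral {Φ : ℝ → ℝ} (h : IsYoungType Φ) {X : Type*}
    [MeasurableSpace X] {ν : Measure X} (hν : ν univ ≤ 1) {m : X → ℝ} (hm : Measurable m)
    (h0 : ∀ x, 0 ≤ m x) {t : ℝ} (ht : 0 ≤ t)
    (htm : ENNReal.ofReal t ≤ ∫⁻ x, ENNReal.ofReal (m x) ∂ν) :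
    ENNReal.ofReal (Φ (t / 2)) ≤ ∫⁻ x, ENNReal.ofReal (Φ (m x)) ∂ν := by
  rcases ht.eq_or_lt with rfl | ht
  · simp [h.map_zero]
  set E : Set X := {x | t / 2 ≤ m x} with hE
  have hEm : MeasurableSet E := measurableSet_le measurable_const hm
  have hc : ∫⁻ x in Eᶜ, ENNReal.ofReal (m x) ∂ν ≤ ENNReal.ofReal (t / 2) := by
    calc ∫⁻ x in Eᶜ, ENNReal.ofReal (m x) ∂ν ≤ ∫⁻ _ in Eᶜ, ENNReal.ofReal (t / 2) ∂ν := by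
          refine setLIntegral_mono measurable_const fun x hx => ENNReal.ofReal_le_ofReal ?_
          simp only [hE, mem_compl_iff, mem_ofPred_eq, not_le] at hx
          exact hx.le
      _ = ENNReal.ofReal (t / 2) * ν Eᶜ := by simp
      _ ≤ ENNReal.ofReal (t / 2) * 1 := by
          gcongr
          exact (measure_mono (subset_univ _)).trans hν
      _ = _ := mul_one _
  have hE2 : ENNReal.ofReal (t / 2) ≤ ∫⁻ x in E, ENNReal.ofReal (m x) ∂ν := by
    rw [← lintegral_add_compl _ hEm] at htm
    have h3 : ENNReal.ofReal t = ENNReal.ofReal (t / 2) + ENNReal.ofReal (t / 2) := by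
      rw [← ENNReal.ofReal_add (by positivity) (by positivity), add_halves]
    rw [h3] at htm
    exact (ENNReal.add_le_add_iff_right ENNReal.ofReal_ne_top).1
      (htm.trans (add_le_add_right hc _))
  have hΦ0 := h.nonneg (half_pos ht).le
  calc ENNReal.ofReal (Φ (t / 2))
      = ENNReal.ofReal (Φ (t / 2) / (t / 2)) * ENNReal.ofReal (t / 2) := by
        rw [← ENNReal.ofReal_mul (by positivity), div_mul_cancel₀ _ (by positivity)]
    _ ≤ ENNReal.ofReal (Φ (t / 2) / (t / 2)) * ∫⁻ x in E, ENNReal.ofReal (m x) ∂ν := by gcongr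
    _ = ∫⁻ x in E, ENNReal.ofReal (Φ (t / 2) / (t / 2)) * ENNReal.ofReal (m x) ∂ν :=
        (lintegral_const_mul' _ _ ENNReal.ofReal_ne_top).symm
    _ ≤ ∫⁻ x in E, ENNReal.ofReal (Φ (m x)) ∂ν := by
        refine setLIntegral_mono
          (measurable_comp_of_monotoneOn h.monotoneOn hm h0).ennreal_ofReal fun x hx => ?_
        have hx' : t / 2 ≤ m x := hx
        have hmx : 0 < m x := (half_pos ht).trans_le hx'
        rw [← ENNReal.ofReal_mul (by positivity)]
        refine ENNReal.ofReal_le_ofReal ?_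
        rw [← le_div_iff₀ hmx]
        exact h.monotoneOn_div (half_pos ht) hmx hx'
    _ ≤ _ := setLIntegral_le_lintegral _ _

lemma ClassU.isYoungType {Φ : ℝ → ℝ} (h : ClassU Φ) : IsYoungType Φ :=
  ⟨h.growth.map_zero, h.growth.monotoneOn, h.monotoneOn_div, h.upperType⟩

/-! ### The inverse of a growth function of class `ℒ` or `𝒰` -/

section Inverse

variable {Φ : ℝ → ℝ}

lemma ClassU.strictMonoOn (h : ClassU Φ) : StrictMonoOn Φ (Ici 0) := by
  intro x hx y hy hxy
  have hx : 0 ≤ x := hx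
  have hy0 : 0 < y := hx.trans_lt hxy
  rcases hx.eq_or_lt with rfl | hx0
  · rw [h.growth.map_zero]; exact h.growth.pos y hy0
  have h1 := h.monotoneOn_div hx0 hy0 hxy.le
  simp only at h1
  rw [div_le_div_iff₀ hx0 hy0] at h1
  have := h.growth.pos x hx0
  by_contra! hc
  nlinarith

/-- A non-decreasing concave function that is constant on some interval is bounded. -/
lemma ClassL.strictMonoOn (h : ClassL Φ) : StrictMonoOn Φ (Ici 0) := by
  intro x hx y hy hxy
  refine (h.growth.monotoneOn hx hy hxy.le).lt_of_ne fun heq => ?_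
  obtain ⟨z, hz, hyz⟩ := ((h.growth.tendsto_atTop.eventually_gt_atTop (Φ y)).and
    (eventually_gt_atTop y)).exists
  have h1 := h.concaveOn.slope_anti_adjacent hx (le_trans (mem_Ici.1 hy) hyz.le) hxy hyz
  rw [heq, sub_self, zero_div, div_le_iff₀ (by linarith)] at h1
  linarith

lemma strictMonoOn_of_class (h : ClassL Φ ∨ ClassU Φ) : StrictMonoOn Φ (Ici 0) :=
  h.elim ClassL.strictMonoOn ClassU.strictMonoOn

lemma growth_of_class (h : ClassL Φ ∨ ClassU Φ) : IsGrowthFunction Φ :=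
  h.elim ClassL.growth ClassU.growth

lemma exists_eq_of_class (h : ClassL Φ ∨ ClassU Φ) {s : ℝ} (hs : 0 ≤ s) :
    ∃ t ∈ Ici (0 : ℝ), Φ t = s := by
  have hg := growth_of_class h
  have hd : ContDiffOn ℝ 1 Φ (Ioi 0) := h.elim ClassL.contDiffOn ClassU.contDiffOn
  have hcont : ContinuousOn Φ (Ici 0) := by
    intro x hx
    rcases (mem_Ici.1 hx).eq_or_lt with rfl | hx0
    · rw [← continuousWithinAt_Ioi_iff_Ici]
      simpa [ContinuousWithinAt, hg.map_zero] using hg.tendsto_zero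
    · exact (hd.continuousOn.continuousAt (Ioi_mem_nhds hx0)).continuousWithinAt
  obtain ⟨T, hT, hT0⟩ := ((hg.tendsto_atTop.eventually_ge_atTop s).and
    (eventually_ge_atTop 0)).exists
  obtain ⟨t, ht, rfl⟩ := intermediate_value_Icc hT0 (hcont.mono Icc_subset_Ici_self)
    ⟨by rwa [hg.map_zero], hT⟩
  exact ⟨t, ht.1, rfl⟩

lemma inverse_nonneg (h : ClassL Φ ∨ ClassU Φ) {s : ℝ} (hs : 0 ≤ s) : 0 ≤ inverse Φ s :=
  Function.invFunOn_mem (exists_eq_of_class h hs)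

lemma map_inverse (h : ClassL Φ ∨ ClassU Φ) {s : ℝ} (hs : 0 ≤ s) : Φ (inverse Φ s) = s :=
  Function.invFunOn_eq (exists_eq_of_class h hs)

lemma inverse_map (h : ClassL Φ ∨ ClassU Φ) {t : ℝ} (ht : 0 ≤ t) : inverse Φ (Φ t) = t :=
  (strictMonoOn_of_class h).injOn.leftInvOn_invFunOn ht

lemma inverse_le_iff (h : ClassL Φ ∨ ClassU Φ) {s t : ℝ} (hs : 0 ≤ s) (ht : 0 ≤ t) :
    inverse Φ s ≤ t ↔ s ≤ Φ t := by
  rw [← (strictMonoOn_of_class h).le_iff_le (inverse_nonneg h hs) ht, map_inverse h hs]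

lemma inverse_pos (h : ClassL Φ ∨ ClassU Φ) {s : ℝ} (hs : 0 < s) : 0 < inverse Φ s := by
  by_contra! hc
  rw [inverse_le_iff h hs.le le_rfl, (growth_of_class h).map_zero] at hc
  linarith

lemma inverse_mono (h : ClassL Φ ∨ ClassU Φ) {s t : ℝ} (hs : 0 ≤ s) (hst : s ≤ t) :
    inverse Φ s ≤ inverse Φ t := by
  rwa [inverse_le_iff h hs (inverse_nonneg h (hs.trans hst)), map_inverse h (hs.trans hst)]

/-- Functions of both classes are of some positive lower type; for the class `𝒰` the exponent
`1` works. -/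
lemma exists_lowerType_of_class (h : ClassL Φ ∨ ClassU Φ) :
    ∃ p C : ℝ, 0 < p ∧ 1 ≤ C ∧
      ∀ θ t : ℝ, 0 ≤ θ → θ ≤ 1 → 0 ≤ t → Φ (θ * t) ≤ C * θ ^ p * Φ t := by
  rcases h with h | h
  · obtain ⟨p, hp, -, C, hC, hΦ⟩ := h.lowerType
    exact ⟨p, C, hp, hC.le, fun θ t h0 h1 ht => by rw [mul_comm θ t]; exact hΦ θ t h0 h1 ht⟩
  · refine ⟨1, 1, one_pos, le_rfl, fun θ t h0 h1 ht => ?_⟩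
    rw [Real.rpow_one, one_mul]
    exact h.isYoungType.map_mul_le h0 h1 ht

lemma exists_scale_of_class (h : ClassL Φ ∨ ClassU Φ) (ε : ℝ) (hε : 0 < ε) :
    ∃ θ : ℝ, 0 < θ ∧ ∀ t : ℝ, 0 ≤ t → Φ (θ * t) ≤ ε * Φ t := by
  obtain ⟨p, C, hp, hC, hΦ⟩ := exists_lowerType_of_class h
  have hC0 : 0 < C := by linarith
  refine ⟨min 1 ((ε / C) ^ p⁻¹), by positivity, fun t ht =>
    (hΦ _ t (by positivity) (min_le_left _ _) ht).trans ?_⟩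
  have ht0 : 0 ≤ Φ t := (growth_of_class h).map_zero ▸
    (growth_of_class h).monotoneOn self_mem_Ici ht ht
  refine mul_le_mul_of_nonneg_right ?_ ht0
  calc C * (min 1 ((ε / C) ^ p⁻¹)) ^ p ≤ C * ((ε / C) ^ p⁻¹) ^ p := by
        gcongr
        exact min_le_right _ _
    _ = ε := by
        rw [← Real.rpow_mul (by positivity), inv_mul_cancel₀ hp.ne', Real.rpow_one]
        field_simp

/-- The function `Φ₁ ∘ Φ₂⁻¹` is of upper type `p₁/p₂` when `Φ₁` is of upper type `p₁` and `Φ₂` is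
of lower type `p₂`; its quotient by the identity is `(Φ₁/Φ₂) ∘ Φ₂⁻¹`. -/
lemma isYoungType_comp_inverse {Φ₁ Φ₂ : ℝ → ℝ} (h₁ : IsYoungType Φ₁)
    (h₂ : ClassL Φ₂ ∨ ClassU Φ₂) (hmono : MonotoneOn (fun t => Φ₁ t / Φ₂ t) (Ioi 0)) :
    IsYoungType (Φ₁ ∘ inverse Φ₂) := by
  have hz : inverse Φ₂ 0 = 0 := by
    conv_lhs => rw [← (growth_of_class h₂).map_zero]
    exact inverse_map h₂ le_rfl
  have hmon : MonotoneOn (Φ₁ ∘ inverse Φ₂) (Ici 0) := fun s hs t ht hst =>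
    h₁.monotoneOn (inverse_nonneg h₂ hs) (inverse_nonneg h₂ ht) (inverse_mono h₂ hs hst)
  refine ⟨by simp [hz, h₁.map_zero], hmon, fun s hs t ht hst => ?_, ?_⟩
  · have := hmono (inverse_pos h₂ hs) (inverse_pos h₂ ht) (inverse_mono h₂ (le_of_lt hs) hst)
    simpa [map_inverse h₂ (le_of_lt (mem_Ioi.1 hs)), map_inverse h₂ (le_of_lt (mem_Ioi.1 ht))]
      using this
  · obtain ⟨p₁, hp₁, C₁, hC₁, hΦ₁⟩ := h₁.upperType
    obtain ⟨p₂, C₂, hp₂, hC₂, hΦ₂⟩ := exists_lowerType_of_class h₂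
    have hC₂0 : 0 < C₂ := by linarith
    -- the exponent is raised to `max 1 (p₁ / p₂)` to meet the normalization `p ≥ 1`
    refine ⟨max 1 (p₁ / p₂), le_max_left _ _, C₁ * C₂ ^ (p₁ / p₂), ?_, fun t s ht hs => ?_⟩
    · have : 1 ≤ C₂ ^ (p₁ / p₂) := Real.one_le_rpow hC₂ (by positivity)
      nlinarith
    have ht0 : 0 < t := by linarith
    set R : ℝ := (C₂ * t) ^ p₂⁻¹ with hR
    have hR1 : 1 ≤ R := Real.one_le_rpow (by nlinarith) (by positivity)
    have hR0 : 0 < R := by linarith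
    have hRp : R ^ p₂ = C₂ * t := by
      rw [hR, ← Real.rpow_mul (by positivity), inv_mul_cancel₀ hp₂.ne', Real.rpow_one]
    set u := inverse Φ₂ s with hu
    have hu0 : 0 ≤ u := inverse_nonneg h₂ hs
    have h3 : inverse Φ₂ (s * t) ≤ u * R := by
      rw [inverse_le_iff h₂ (by positivity) (by positivity)]
      have h4 := hΦ₂ R⁻¹ (u * R) (by positivity) (inv_le_one_of_one_le₀ hR1) (by positivity)
      rw [show R⁻¹ * (u * R) = u by field_simp, map_inverse h₂ hs, Real.inv_rpow hR0.le, hRp] at h4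
      rw [show C₂ * (C₂ * t)⁻¹ = t⁻¹ by field_simp, inv_mul_eq_div, le_div_iff₀ ht0] at h4
      exact h4
    have hΦu : 0 ≤ Φ₁ u := h₁.nonneg hu0
    calc (Φ₁ ∘ inverse Φ₂) (s * t) ≤ Φ₁ (u * R) :=
          h₁.monotoneOn (inverse_nonneg h₂ (by positivity)) (mem_Ici.2 (by positivity)) h3
      _ ≤ C₁ * R ^ p₁ * Φ₁ u := hΦ₁ R u hR1 hu0
      _ = C₁ * C₂ ^ (p₁ / p₂) * t ^ (p₁ / p₂) * Φ₁ u := by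
          rw [hR, ← Real.rpow_mul (by positivity), Real.mul_rpow hC₂0.le ht0.le,
            inv_mul_eq_div]
          ring
      _ ≤ C₁ * C₂ ^ (p₁ / p₂) * t ^ (max 1 (p₁ / p₂)) * Φ₁ u := by
          gcongr
          exact le_max_right _ _

end Inverse

/-! ### Integrals of powers of `|z - w̄|` over the upper half-plane -/

lemma lintegral_ofReal_le {X : Type*} [MeasurableSpace X] {ν : Measure X} {f : X → ℝ}
    (hf : Integrable f ν) (h0 : 0 ≤ᵐ[ν] f) {B : ℝ} (hB : ∫ x, f x ∂ν ≤ B) :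
    ∫⁻ x, ENNReal.ofReal (f x) ∂ν ≤ ENNReal.ofReal B := by
  rw [← ofReal_integral_eq_lintegral_ofReal hf h0]
  exact ENNReal.ofReal_le_ofReal hB

lemma setLIntegral_Ioi_rpow_le {c r : ℝ} (hr : r < -1) (hc : 0 < c) :
    ∫⁻ t in Ioi c, ENNReal.ofReal (t ^ r) ≤ ENNReal.ofReal (c ^ (r + 1) / (-1 - r)) := by
  refine lintegral_ofReal_le (integrableOn_Ioi_rpow_of_lt hr hc)
    ((ae_restrict_mem measurableSet_Ioi).mono fun t ht =>
      Real.rpow_nonneg (hc.trans ht).le _) ?_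
  rw [integral_Ioi_rpow_of_lt hr hc, show -1 - r = -(r + 1) by ring, div_neg, neg_div]

lemma setLIntegral_Ioc_rpow_le {c r : ℝ} (hr : -1 < r) (hc : 0 < c) :
    ∫⁻ t in Ioc 0 c, ENNReal.ofReal (t ^ r) ≤ ENNReal.ofReal (c ^ (r + 1) / (r + 1)) := by
  have hi : IntervalIntegrable (fun t : ℝ => t ^ r) volume 0 c :=
    intervalIntegral.intervalIntegrable_rpow' hr
  refine lintegral_ofReal_le ((intervalIntegrable_iff_integrableOn_Ioc_of_le hc.le).1 hi)
    ((ae_restrict_mem measurableSet_Ioc).mono fun t ht => Real.rpow_nonneg ht.1.le _) ?_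
  rw [← intervalIntegral.integral_of_le hc.le, integral_rpow (Or.inl hr),
    Real.zero_rpow (by linarith), sub_zero]

lemma lintegral_horizontal_le {c : ℝ} (hc : 1 < c) : ∃ B : ℝ, 0 < B ∧ ∀ u Y : ℝ, 0 < Y →
    ∫⁻ x : ℝ, ENNReal.ofReal ((√((x - u) ^ 2 + Y ^ 2) ^ c)⁻¹) ≤
      ENNReal.ofReal (B * Y ^ (1 - c)) := by
  have hint : Integrable fun x : ℝ => (1 + ‖x‖ ^ 2) ^ (-c / 2) :=
    integrable_rpow_neg_one_add_norm_sq (by simpa using hc)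
  have hI : 0 ≤ ∫ x : ℝ, (1 + ‖x‖ ^ 2) ^ (-c / 2) := integral_nonneg fun x => by positivity
  refine ⟨(∫ x : ℝ, (1 + ‖x‖ ^ 2) ^ (-c / 2)) + 1, by positivity, fun u Y hY => ?_⟩
  rw [lintegral_sub_right_eq_self (fun x => ENNReal.ofReal ((√(x ^ 2 + Y ^ 2) ^ c)⁻¹)) u]
  have hpt : ∀ x : ℝ, (√(x ^ 2 + Y ^ 2) ^ c)⁻¹ = Y ^ (-c) * (1 + ‖x / Y‖ ^ 2) ^ (-c / 2) := by
    intro x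
    have h1 : x ^ 2 + Y ^ 2 = Y ^ 2 * (1 + ‖x / Y‖ ^ 2) := by
      rw [Real.norm_eq_abs, sq_abs]; field_simp; ring
    have h2 : 0 < 1 + ‖x / Y‖ ^ 2 := by positivity
    rw [h1, Real.sqrt_eq_rpow, ← Real.rpow_mul (by positivity), ← Real.rpow_neg (by positivity),
      Real.mul_rpow (by positivity) h2.le, ← Real.rpow_natCast, ← Real.rpow_mul hY.le]
    congr 2 <;> push_cast <;> ring
  simp_rw [hpt]
  have hi2 : Integrable fun x : ℝ => Y ^ (-c) * (1 + ‖x / Y‖ ^ 2) ^ (-c / 2) :=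
    (hint.comp_div hY.ne').const_mul _
  refine lintegral_ofReal_le hi2 (ae_of_all _ fun x => by positivity) ?_
  rw [integral_const_mul, Measure.integral_comp_div (fun x : ℝ => (1 + ‖x‖ ^ 2) ^ (-c / 2)),
    abs_of_pos hY, smul_eq_mul, ← mul_assoc, ← Real.rpow_add_one hY.ne', mul_comm]
  rw [show -c + 1 = 1 - c by ring]
  gcongr
  linarith

lemma setLIntegral_vertical_le {s c : ℝ} (hs : -1 < s) (hc : s + 2 < c) :
    ∃ B : ℝ, 0 < B ∧ ∀ v : ℝ, 0 < v →
      ∫⁻ y in Ioi (0 : ℝ), ENNReal.ofReal (y ^ s * (y + v) ^ (1 - c)) ≤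
        ENNReal.ofReal (B * v ^ (s + 2 - c)) := by
  have h1 : 0 < s + 1 := by linarith
  have h2 : 0 < c - s - 2 := by linarith
  refine ⟨(s + 1)⁻¹ + (c - s - 2)⁻¹, by positivity, fun v hv => ?_⟩
  rw [← Ioc_union_Ioi_eq_Ioi hv.le]
  refine (lintegral_union_le _ _ _).trans ?_
  rw [add_mul, ENNReal.ofReal_add (by positivity) (by positivity)]
  gcongr
  · calc ∫⁻ y in Ioc 0 v, ENNReal.ofReal (y ^ s * (y + v) ^ (1 - c))
        ≤ ∫⁻ y in Ioc 0 v, ENNReal.ofReal (v ^ (1 - c)) * ENNReal.ofReal (y ^ s) := by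
          refine setLIntegral_mono (by fun_prop) fun y hy => ?_
          have hy0 : 0 < y := hy.1
          have h3 : (y + v) ^ (1 - c) ≤ v ^ (1 - c) :=
            Real.rpow_le_rpow_of_nonpos hv (by linarith) (by linarith)
          rw [← ENNReal.ofReal_mul (by positivity), mul_comm (v ^ (1 - c))]
          gcongr
      _ = ENNReal.ofReal (v ^ (1 - c)) * ∫⁻ y in Ioc 0 v, ENNReal.ofReal (y ^ s) :=
          lintegral_const_mul' _ _ ENNReal.ofReal_ne_top
      _ ≤ ENNReal.ofReal (v ^ (1 - c)) * ENNReal.ofReal (v ^ (s + 1) / (s + 1)) := by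
          gcongr
          exact setLIntegral_Ioc_rpow_le hs hv
      _ = _ := by
          rw [← ENNReal.ofReal_mul (by positivity), ← mul_div_assoc, ← Real.rpow_add hv,
            div_eq_inv_mul]
          congr 3; ring
  · calc ∫⁻ y in Ioi v, ENNReal.ofReal (y ^ s * (y + v) ^ (1 - c))
        ≤ ∫⁻ y in Ioi v, ENNReal.ofReal (y ^ (s + 1 - c)) := by
          refine setLIntegral_mono (by fun_prop) fun y hy => ?_
          have hy0 : 0 < y := hv.trans hy
          refine ENNReal.ofReal_le_ofReal ?_
          rw [show s + 1 - c = s + (1 - c) by ring, Real.rpow_add hy0]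
          gcongr ?_ * ?_
          exact Real.rpow_le_rpow_of_nonpos hy0 (by linarith) (by linarith)
      _ ≤ _ := setLIntegral_Ioi_rpow_le (by linarith) hv
      _ = _ := by
          rw [div_eq_inv_mul]
          congr 3 <;> ring

lemma measurableSet_upperHalfPlaneSet : MeasurableSet upperHalfPlaneSet :=
  isOpen_upperHalfPlaneSet.measurableSet

lemma norm_sub_conj (z w : ℂ) :
    ‖z - (starRingEnd ℂ) w‖ = √((z.re - w.re) ^ 2 + (z.im + w.im) ^ 2) := by
  rw [Complex.norm_eq_sqrt_sq_add_sq]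
  simp

lemma norm_sub_conj_comm (z w : ℂ) :
    ‖z - (starRingEnd ℂ) w‖ = ‖w - (starRingEnd ℂ) z‖ := by
  rw [norm_sub_conj, norm_sub_conj, add_comm w.im, ← neg_sub w.re, neg_sq]

lemma norm_sub_conj_pos {z w : ℂ} (hz : 0 < z.im) (hw : 0 < w.im) :
    0 < ‖z - (starRingEnd ℂ) w‖ := by
  rw [norm_sub_conj]; positivity

lemma lintegral_upperHalfPlane_le {s c : ℝ} (hs : -1 < s) (hc : s + 2 < c) :
    ∃ B : ℝ, 0 < B ∧ ∀ w : ℂ, 0 < w.im →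
      ∫⁻ z in upperHalfPlaneSet, ENNReal.ofReal (z.im ^ s / ‖z - (starRingEnd ℂ) w‖ ^ c) ≤
        ENNReal.ofReal (B * w.im ^ (s + 2 - c)) := by
  obtain ⟨B₁, hB₁, h₁⟩ := lintegral_horizontal_le (c := c) (by linarith)
  obtain ⟨B₂, hB₂, h₂⟩ := setLIntegral_vertical_le hs hc
  refine ⟨B₁ * B₂, by positivity, fun w hw => ?_⟩
  set f : ℝ × ℝ → ℝ≥0∞ := fun p => (Ioi (0 : ℝ)).indicator
    (fun y => ENNReal.ofReal (y ^ s)) p.2 *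
      ENNReal.ofReal ((√((p.1 - w.re) ^ 2 + (p.2 + w.im) ^ 2) ^ c)⁻¹) with hf
  have hfm : Measurable f := by
    refine Measurable.mul ?_ (by fun_prop)
    exact (Measurable.indicator (by fun_prop) measurableSet_Ioi).comp measurable_snd
  have h3 : ∫⁻ z in upperHalfPlaneSet,
      ENNReal.ofReal (z.im ^ s / ‖z - (starRingEnd ℂ) w‖ ^ c) = ∫⁻ p, f p := by
    rw [← Complex.volume_preserving_equiv_real_prod.lintegral_comp hfm,
      ← lintegral_indicator measurableSet_upperHalfPlaneSet]
    refine lintegral_congr fun z => ?_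
    by_cases hz : z ∈ upperHalfPlaneSet
    · have hz' : 0 < z.im := hz
      simp [hf, hz, hz', norm_sub_conj, ← ENNReal.ofReal_mul (Real.rpow_nonneg hz'.le s),
        div_eq_mul_inv]
    · have hz' : ¬ 0 < z.im := hz
      simp [hf, hz, hz']
  rw [h3, Measure.volume_eq_prod, lintegral_prod_symm _ hfm.aemeasurable]
  calc ∫⁻ y, ∫⁻ x, f (x, y)
      ≤ ∫⁻ y, (Ioi (0 : ℝ)).indicator (fun y => ENNReal.ofReal B₁ *
          ENNReal.ofReal (y ^ s * (y + w.im) ^ (1 - c))) y := by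
        refine lintegral_mono fun y => ?_
        by_cases hy : y ∈ Ioi (0 : ℝ)
        · have hy' : 0 < y := hy
          simp only [hf, indicator_of_mem hy]
          rw [lintegral_const_mul' _ _ ENNReal.ofReal_ne_top]
          refine (mul_le_mul_right (h₁ w.re (y + w.im) (by positivity)) _).trans_eq ?_
          rw [← ENNReal.ofReal_mul (by positivity), ← ENNReal.ofReal_mul (by positivity)]
          congr 1; ring
        · simp [hf, indicator_of_notMem hy]
    _ = ENNReal.ofReal B₁ * ∫⁻ y in Ioi (0 : ℝ),
          ENNReal.ofReal (y ^ s * (y + w.im) ^ (1 - c)) := by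
        rw [lintegral_indicator measurableSet_Ioi, lintegral_const_mul' _ _ ENNReal.ofReal_ne_top]
    _ ≤ ENNReal.ofReal B₁ * ENNReal.ofReal (B₂ * w.im ^ (s + 2 - c)) := by
        gcongr; exact h₂ _ hw
    _ = _ := by rw [← ENNReal.ofReal_mul (by positivity), mul_assoc]

/-! ### A modular inequality for Bergman-type integral operators -/

instance (α : ℝ) : SFinite (V α) := by unfold V; infer_instance

lemma lintegral_V (α : ℝ) (f : ℂ → ℝ≥0∞) :
    ∫⁻ z, f z ∂V α = ∫⁻ z in upperHalfPlaneSet, ENNReal.ofReal (z.im ^ α) * f z := by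
  unfold V
  rw [lintegral_withDensity_eq_lintegral_mul_non_measurable _ (by fun_prop)
    (ae_of_all _ fun _ => ENNReal.ofReal_lt_top)]
  rfl

lemma ae_V_mem (α : ℝ) : ∀ᵐ z ∂V α, z ∈ upperHalfPlaneSet :=
  (withDensity_absolutelyContinuous _ _).ae_le (ae_restrict_mem measurableSet_upperHalfPlaneSet)

/-- The kernel `y^r v^(b-2-α-r) / |z - w̄|^b`, where `y = Im z` and `v = Im w`. Its degree of
homogeneity `-2-α` is the one for which the integral operator with this kernel with respect to
`V α` commutes with dilations. -/
noncomputable def powKernel (α b r : ℝ) (z w : ℂ) : ℝ :=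
  z.im ^ r * w.im ^ (b - 2 - α - r) / ‖z - (starRingEnd ℂ) w‖ ^ b

lemma powKernel_swap (α b r : ℝ) (z w : ℂ) :
    powKernel α b r z w = powKernel α b (b - 2 - α - r) w z := by
  unfold powKernel
  rw [norm_sub_conj_comm z w, mul_comm (z.im ^ r)]
  congr 3; ring

lemma powKernel_nonneg {α b r : ℝ} {z w : ℂ} (hz : 0 ≤ z.im) (hw : 0 ≤ w.im) :
    0 ≤ powKernel α b r z w := by
  unfold powKernel; positivity

lemma measurable_powKernel (α b r : ℝ) : Measurable fun p : ℂ × ℂ => powKernel α b r p.1 p.2 := by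
  unfold powKernel; fun_prop

lemma lintegral_powKernel_right_le {α b r : ℝ} (hr : 0 < r) (hb : r + 1 < b) :
    ∃ B : ℝ, 0 < B ∧ ∀ z ∈ upperHalfPlaneSet,
      ∫⁻ w, ENNReal.ofReal (powKernel α b r z w) ∂V α ≤ ENNReal.ofReal B := by
  obtain ⟨B, hB, h⟩ := lintegral_upperHalfPlane_le (s := b - 2 - r) (c := b) (by linarith)
    (by linarith)
  refine ⟨B, hB, fun z hz => ?_⟩
  have hz' : 0 < z.im := hz
  rw [lintegral_V]
  calc ∫⁻ w in upperHalfPlaneSet,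
        ENNReal.ofReal (w.im ^ α) * ENNReal.ofReal (powKernel α b r z w)
      = ∫⁻ w in upperHalfPlaneSet, ENNReal.ofReal (z.im ^ r) *
          ENNReal.ofReal (w.im ^ (b - 2 - r) / ‖w - (starRingEnd ℂ) z‖ ^ b) := by
        refine setLIntegral_congr_fun measurableSet_upperHalfPlaneSet fun w hw => ?_
        have hw' : 0 < w.im := hw
        rw [← ENNReal.ofReal_mul (by positivity), ← ENNReal.ofReal_mul (by positivity), powKernel,
          norm_sub_conj_comm z w, show b - 2 - r = α + (b - 2 - α - r) by ring,
          Real.rpow_add hw']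
        congr 1; ring
    _ = ENNReal.ofReal (z.im ^ r) * ∫⁻ w in upperHalfPlaneSet,
          ENNReal.ofReal (w.im ^ (b - 2 - r) / ‖w - (starRingEnd ℂ) z‖ ^ b) :=
        lintegral_const_mul' _ _ ENNReal.ofReal_ne_top
    _ ≤ ENNReal.ofReal (z.im ^ r) * ENNReal.ofReal (B * z.im ^ (b - 2 - r + 2 - b)) := by
        gcongr; exact h z hz'
    _ = ENNReal.ofReal B := by
        rw [← ENNReal.ofReal_mul (by positivity), mul_left_comm, ← Real.rpow_add hz',
          show r + (b - 2 - r + 2 - b) = 0 by ring, Real.rpow_zero, mul_one]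

lemma lintegral_powKernel_left_le {α b r : ℝ} (hr : -1 < r + α) (hb : r + α + 2 < b) :
    ∃ B : ℝ, 0 < B ∧ ∀ w ∈ upperHalfPlaneSet,
      ∫⁻ z, ENNReal.ofReal (powKernel α b r z w) ∂V α ≤ ENNReal.ofReal B := by
  simp_rw [powKernel_swap α b r]
  exact lintegral_powKernel_right_le (by linarith) (by linarith)

/-- For `b > α + 2`, the operator with kernel `v^(b-2-α) / |z - w̄|^b` satisfies a modular
inequality for every function of upper type with `Φ(t)/t` non-decreasing. The kernel itself is not
integrable in `w`; multiplying it by `(y/v)^a` with a small `a > 0` makes it so, uniformly in `z`.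
Jensen's inequality for the resulting kernel, applied to `(v/y)^a m(w)`, and the upper type of `Φ`
leave kernels which are integrable in `z`. The bound is stated through a majorant `J` of
`Φ` composed with the operator, so that infinite values of the latter need no convention. -/
theorem IsYoungType.exists_modular_bound {Φ : ℝ → ℝ} (h : IsYoungType Φ) {α b : ℝ}
    (hα : -1 < α) (hb : α + 2 < b) :
    ∃ C : ℝ, 0 < C ∧ ∀ m : ℂ → ℝ, Measurable m → (∀ z, 0 ≤ m z) → ∃ J : ℂ → ℝ≥0∞,
      Measurable J ∧
      (∀ z ∈ upperHalfPlaneSet, ∀ t : ℝ, 0 ≤ t →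
        ENNReal.ofReal t ≤ ∫⁻ w, ENNReal.ofReal (powKernel α b 0 z w * m w) ∂V α →
        ENNReal.ofReal (Φ t) ≤ J z) ∧
      ∫⁻ z, J z ∂V α ≤ ENNReal.ofReal C * ∫⁻ w, ENNReal.ofReal (Φ (m w)) ∂V α := by
  obtain ⟨p, C₁, hp, hC₁, hΦ⟩ := h.exists_map_mul_le
  set a : ℝ := min ((b - 1) / 2) ((α + 1) / (2 * p)) with ha
  have ha0 : 0 < a := lt_min (by linarith) (div_pos (by linarith) (by linarith))
  have ha1 : a + 1 < b := by
    have : a ≤ (b - 1) / 2 := min_le_left _ _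
    linarith
  have hap : a * p ≤ (α + 1) / 2 := by
    have : a ≤ (α + 1) / (2 * p) := min_le_right _ _
    rw [le_div_iff₀ (by linarith)] at this
    linarith
  have hap' : a ≤ a * p := by nlinarith
  obtain ⟨B, hB, hBle⟩ := lintegral_powKernel_right_le (α := α) ha0 ha1
  obtain ⟨B₁, hB₁, hB₁le⟩ := lintegral_powKernel_left_le (α := α) (b := b) (r := 0)
    (by linarith) (by linarith)
  obtain ⟨B₂, hB₂, hB₂le⟩ := lintegral_powKernel_left_le (α := α) (b := b) (r := a - a * p)
    (by linarith) (by linarith)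
  obtain ⟨C₂, hC₂, hΦ₂⟩ := h.exists_map_mul_le_const (2 * B) (by positivity)
  refine ⟨C₂ * B⁻¹ * C₁ * (B₁ + B₂), by positivity, fun m hm hm0 => ?_⟩
  have hΦm : Measurable fun w => Φ (m w) := measurable_comp_of_monotoneOn h.monotoneOn hm hm0
  set k : ℂ → ℂ → ℝ≥0∞ := fun z w => ENNReal.ofReal (powKernel α b 0 z w) +
    ENNReal.ofReal (powKernel α b (a - a * p) z w) with hk
  have hkm : Measurable fun q : ℂ × ℂ => k q.1 q.2 :=
    (measurable_powKernel α b 0).ennreal_ofReal.add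
      (measurable_powKernel α b (a - a * p)).ennreal_ofReal
  have hkΦ : Measurable fun q : ℂ × ℂ => k q.1 q.2 * ENNReal.ofReal (Φ (m q.2)) :=
    hkm.mul (hΦm.comp measurable_snd).ennreal_ofReal
  refine ⟨fun z => ENNReal.ofReal (C₂ * B⁻¹ * C₁) *
    ∫⁻ w, k z w * ENNReal.ofReal (Φ (m w)) ∂V α, ?_, ?_, ?_⟩
  · exact (Measurable.lintegral_prod_right' hkΦ).const_mul _
  · intro z hz t ht htm
    have hy : 0 < z.im := hz
    -- the measure of mass at most `1` to which the substitute for Jensen's inequality is applied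
    set κ : ℂ → ℝ≥0∞ := fun w => ENNReal.ofReal (powKernel α b a z w) with hκ
    have hκm : Measurable κ :=
      ((measurable_powKernel α b a).comp measurable_prodMk_left).ennreal_ofReal
    set ν : Measure ℂ := ENNReal.ofReal B⁻¹ • (V α).withDensity κ with hν
    have hν1 : ν univ ≤ 1 := by
      rw [hν, Measure.smul_apply, withDensity_apply _ MeasurableSet.univ, Measure.restrict_univ,
        smul_eq_mul]
      calc _ ≤ ENNReal.ofReal B⁻¹ * ENNReal.ofReal B := by gcongr; exact hBle z hz
        _ = 1 := by
          rw [← ENNReal.ofReal_mul (by positivity), inv_mul_cancel₀ hB.ne', ENNReal.ofReal_one]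
    have hνint : ∀ g : ℂ → ℝ≥0∞, ∫⁻ w, g w ∂ν =
        ENNReal.ofReal B⁻¹ * ∫⁻ w, κ w * g w ∂V α := by
      intro g
      rw [hν, lintegral_smul_measure, lintegral_withDensity_eq_lintegral_mul_non_measurable _ hκm
        (ae_of_all _ fun _ => ENNReal.ofReal_lt_top)]
      rfl
    set m' : ℂ → ℝ := fun w => (|w.im| / z.im) ^ a * m w with hm'
    have hm'm : Measurable m' := by fun_prop
    have hm'0 : ∀ w, 0 ≤ m' w := fun w => mul_nonneg (by positivity) (hm0 w)
    have h1 : ENNReal.ofReal (B⁻¹ * t) ≤ ∫⁻ w, ENNReal.ofReal (m' w) ∂ν := by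
      rw [hνint, ENNReal.ofReal_mul (by positivity)]
      gcongr
      refine htm.trans_eq (lintegral_congr_ae ?_)
      filter_upwards [ae_V_mem α] with w hw
      have hw' : 0 < w.im := hw
      simp only [hκ, hm']
      rw [← ENNReal.ofReal_mul (powKernel_nonneg hy.le hw'.le), abs_of_pos hw',
        Real.div_rpow hw'.le hy.le, powKernel, powKernel, sub_zero,
        show b - 2 - α = (b - 2 - α - a) + a by ring, Real.rpow_add hw', Real.rpow_zero]
      have := Real.rpow_pos_of_pos hy a
      congr 1
      rw [show b - 2 - α - a + a - a = b - 2 - α - a by ring]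
      field_simp
    have h2 := h.map_half_le_lintegral hν1 hm'm hm'0 (by positivity) h1
    have h3 : Φ t ≤ C₂ * Φ (B⁻¹ * t / 2) := by
      have := hΦ₂ (B⁻¹ * t / 2) (by positivity)
      rwa [show 2 * B * (B⁻¹ * t / 2) = t by field_simp] at this
    calc ENNReal.ofReal (Φ t) ≤ ENNReal.ofReal C₂ * ENNReal.ofReal (Φ (B⁻¹ * t / 2)) := by
          rw [← ENNReal.ofReal_mul hC₂.le]
          exact ENNReal.ofReal_le_ofReal h3
      _ ≤ ENNReal.ofReal C₂ * (ENNReal.ofReal B⁻¹ * (ENNReal.ofReal C₁ *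
            ∫⁻ w, k z w * ENNReal.ofReal (Φ (m w)) ∂V α)) := by
          gcongr
          refine h2.trans ?_
          rw [hνint]
          gcongr
          rw [← lintegral_const_mul' _ _ ENNReal.ofReal_ne_top]
          refine lintegral_mono_ae ?_
          filter_upwards [ae_V_mem α] with w hw
          have hw' : 0 < w.im := hw
          have hΦ0 := h.nonneg (hm0 w)
          simp only [hκ, hm', hk]
          rw [← ENNReal.ofReal_mul (powKernel_nonneg hy.le hw'.le), abs_of_pos hw',
            ← ENNReal.ofReal_add (powKernel_nonneg hy.le hw'.le) (powKernel_nonneg hy.le hw'.le),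
            ← ENNReal.ofReal_mul (add_nonneg (powKernel_nonneg hy.le hw'.le)
              (powKernel_nonneg hy.le hw'.le)), ← ENNReal.ofReal_mul (by positivity)]
          refine ENNReal.ofReal_le_ofReal ?_
          have h4 := hΦ ((w.im / z.im) ^ a) (m w) (by positivity) (hm0 w)
          have h5 : ∀ q : ℝ, powKernel α b a z w * (w.im / z.im) ^ (a * q) =
              powKernel α b (a - a * q) z w := by
            intro q
            rw [powKernel, powKernel, Real.div_rpow hw'.le hy.le, Real.rpow_sub hy,
              show b - 2 - α - (a - a * q) = (b - 2 - α - a) + a * q by ring, Real.rpow_add hw']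
            have := Real.rpow_pos_of_pos hy (a * q)
            field_simp
          have h6 := h5 1
          have h7 := h5 p
          rw [Real.rpow_mul (by positivity)] at h7
          rw [mul_one, sub_self] at h6
          calc powKernel α b a z w * Φ ((w.im / z.im) ^ a * m w)
              ≤ powKernel α b a z w * (C₁ * ((w.im / z.im) ^ a + ((w.im / z.im) ^ a) ^ p) *
                  Φ (m w)) := mul_le_mul_of_nonneg_left h4 (powKernel_nonneg hy.le hw'.le)
            _ = C₁ * ((powKernel α b a z w * (w.im / z.im) ^ a +
                  powKernel α b a z w * ((w.im / z.im) ^ a) ^ p) * Φ (m w)) := by ring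
            _ = _ := by rw [h6, h7]
      _ = _ := by
          rw [ENNReal.ofReal_mul (by positivity), ENNReal.ofReal_mul (by positivity)]
          ring
  · rw [lintegral_const_mul _ (Measurable.lintegral_prod_right' hkΦ),
      lintegral_lintegral_swap hkΦ.aemeasurable,
      ENNReal.ofReal_mul (p := C₂ * B⁻¹ * C₁) (by positivity),
      mul_assoc (ENNReal.ofReal _)]
    gcongr
    rw [← lintegral_const_mul' _ _ ENNReal.ofReal_ne_top]
    refine lintegral_mono_ae ?_
    filter_upwards [ae_V_mem α] with w hw
    rw [lintegral_mul_const' _ _ ENNReal.ofReal_ne_top, ENNReal.ofReal_add hB₁.le hB₂.le]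
    gcongr
    simp only [hk]
    rw [lintegral_add_left (f := fun z => ENNReal.ofReal (powKernel α b 0 z w))
      ((measurable_powKernel α b 0).comp measurable_prodMk_right).ennreal_ofReal]
    exact add_le_add (hB₁le w hw) (hB₂le w hw)

/-! ### The area mean value inequality -/

lemma measurable_indicator_of_continuousOn {γ : Type*} [TopologicalSpace γ] [MeasurableSpace γ]
    [BorelSpace γ] [Zero γ] {f : ℂ → γ} {s : Set ℂ} (hs : IsOpen s) (hf : ContinuousOn f s) :
    Measurable (s.indicator f) := by
  classical
  rw [← piecewise_eq_indicator]
  exact ContinuousOn.measurable_piecewise hf continuousOn_const hs.measurableSet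

lemma enorm_le_lintegral_circle {F : ℂ → ℂ} {w : ℂ} {R ρ : ℝ} (hρ : 0 < ρ) (hρR : ρ < R)
    (hF : DifferentiableOn ℂ F (Metric.ball w R)) :
    ENNReal.ofReal (2 * Real.pi) * ‖F w‖ₑ ≤
      ∫⁻ θ in Ioo (-Real.pi) Real.pi, ‖F (circleMap w ρ θ)‖ₑ := by
  have hd : DiffContOnCl ℂ F (Metric.ball w |ρ|) := by
    rw [abs_of_pos hρ]
    refine DifferentiableOn.diffContOnCl ?_
    rw [closure_ball _ hρ.ne']
    exact hF.mono (Metric.closedBall_subset_ball hρR)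
  have hπ := Real.pi_pos
  have h1 := hd.circleAverage
  rw [Real.circleAverage_eq_integral_add (-Real.pi),
    intervalIntegral.integral_comp_add_right (fun θ => F (circleMap w ρ θ)), zero_add,
    show 2 * Real.pi + -Real.pi = Real.pi by ring,
    intervalIntegral.integral_of_le (by linarith)] at h1
  have h2 : ((2 * Real.pi : ℝ)) • F w = ∫ θ in Ioc (-Real.pi) Real.pi, F (circleMap w ρ θ) := by
    rw [← h1, smul_smul, mul_inv_cancel₀ (by positivity), one_smul]
  rw [restrict_Ioo_eq_restrict_Ioc]
  calc ENNReal.ofReal (2 * Real.pi) * ‖F w‖ₑ = ‖((2 * Real.pi : ℝ)) • F w‖ₑ := by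
        rw [enorm_smul, Real.enorm_of_nonneg (by positivity)]
    _ ≤ _ := by
        rw [h2]
        exact enorm_integral_le_lintegral_enorm _

lemma enorm_le_lintegral_ball {F : ℂ → ℂ} {w : ℂ} {R : ℝ} (hR : 0 < R)
    (hF : DifferentiableOn ℂ F (Metric.ball w R)) :
    ENNReal.ofReal (Real.pi * R ^ 2) * ‖F w‖ₑ ≤ ∫⁻ z in Metric.ball w R, ‖F z‖ₑ := by
  have hπ := Real.pi_pos
  have hm : Measurable ((Metric.ball w R).indicator fun z => ‖F z‖ₑ) :=
    measurable_indicator_of_continuousOn Metric.isOpen_ball hF.continuousOn.enorm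
  set f : ℂ → ℝ≥0∞ := fun p => (Metric.ball w R).indicator (fun z => ‖F z‖ₑ) (w + p) with hf
  have hfm : Measurable f := by fun_prop
  have h2 : ∫⁻ z in Metric.ball w R, ‖F z‖ₑ = ∫⁻ p, f p := by
    rw [← lintegral_indicator Metric.isOpen_ball.measurableSet]
    exact (lintegral_add_left_eq_self _ w).symm
  have hcont : Continuous fun p : ℝ × ℝ => Complex.polarCoord.symm p := by
    simp only [Complex.polarCoord_symm_apply]
    fun_prop
  have hm2 : Measurable fun p : ℝ × ℝ => ENNReal.ofReal p.1 • f (Complex.polarCoord.symm p) :=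
    (measurable_fst.ennreal_ofReal).smul (hfm.comp hcont.measurable)
  rw [h2, ← Complex.lintegral_comp_polarCoord_symm, polarCoord_target, Measure.volume_eq_prod,
    ← Measure.prod_restrict, lintegral_prod _ hm2.aemeasurable]
  calc ENNReal.ofReal (Real.pi * R ^ 2) * ‖F w‖ₑ
      = ENNReal.ofReal (2 * Real.pi) * ‖F w‖ₑ * ∫⁻ r in Ioc 0 R, ENNReal.ofReal (r ^ (1 : ℝ)) := by
        have hi : IntervalIntegrable (fun t : ℝ => t ^ (1 : ℝ)) volume 0 R :=
          intervalIntegral.intervalIntegrable_rpow' (by norm_num)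
        rw [← ofReal_integral_eq_lintegral_ofReal
          ((intervalIntegrable_iff_integrableOn_Ioc_of_le hR.le).1 hi)
          ((ae_restrict_mem measurableSet_Ioc).mono fun t ht => Real.rpow_nonneg ht.1.le _),
          ← intervalIntegral.integral_of_le hR.le, integral_rpow (Or.inl (by norm_num)),
          mul_right_comm, ← ENNReal.ofReal_mul (by positivity), Real.zero_rpow (by norm_num)]
        norm_num
        congr 2; ring
    _ = ∫⁻ r in Ioo 0 R, ENNReal.ofReal (2 * Real.pi) * ‖F w‖ₑ * ENNReal.ofReal (r ^ (1 : ℝ)) := by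
        rw [lintegral_const_mul _ (by fun_prop), restrict_Ioo_eq_restrict_Ioc]
    _ ≤ ∫⁻ r in Ioo 0 R, ∫⁻ θ in Ioo (-Real.pi) Real.pi,
          ENNReal.ofReal r • f (Complex.polarCoord.symm (r, θ)) := by
        refine setLIntegral_mono' measurableSet_Ioo fun r hr => ?_
        simp only [smul_eq_mul]
        rw [lintegral_const_mul' _ _ ENNReal.ofReal_ne_top, Real.rpow_one, mul_comm]
        gcongr
        refine (enorm_le_lintegral_circle hr.1 hr.2 hF).trans_eq ?_
        refine lintegral_congr fun θ => ?_
        have h3 : w + Complex.polarCoord.symm (r, θ) = circleMap w r θ := by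
          simp [circleMap, Complex.exp_mul_I]
        have h4 : circleMap w r θ ∈ Metric.ball w R := by
          simp [abs_of_pos hr.1, hr.2, circleMap]
        simp only [hf]
        rw [h3, indicator_of_mem h4]
    _ ≤ _ := lintegral_mono_set Ioo_subset_Ioi_self

/-! ### A Whitney decomposition of the upper half-plane -/

/-- The side length `2^j` of the tile with index `(j, k)`. -/
noncomputable def side (q : ℤ × ℤ) : ℝ := (2 : ℝ) ^ q.1

/-- The tile with index `(j, k)`: the half-open square with lower left corner `2^j (k + i)` and side
length `2^j`. -/
def tile (q : ℤ × ℤ) : Set ℂ :=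
  {z | z.re ∈ Ico (q.2 * side q) ((q.2 + 1) * side q) ∧ z.im ∈ Ico (side q) (2 * side q)}

/-- The lower left corner of a tile. -/
noncomputable def corner (q : ℤ × ℤ) : ℂ := ⟨q.2 * side q, side q⟩

lemma side_pos (q : ℤ × ℤ) : 0 < side q := by unfold side; positivity

@[simp] lemma corner_im (q : ℤ × ℤ) : (corner q).im = side q := rfl

lemma corner_mem_tile (q : ℤ × ℤ) : corner q ∈ tile q := by
  have := side_pos q
  refine ⟨⟨le_rfl, ?_⟩, ⟨le_rfl, ?_⟩⟩ <;> simp only [corner] <;> nlinarith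

lemma tile_subset (q : ℤ × ℤ) : tile q ⊆ upperHalfPlaneSet := fun _ hz =>
  (side_pos q).trans_le hz.2.1

lemma corner_mem (q : ℤ × ℤ) : corner q ∈ upperHalfPlaneSet := tile_subset q (corner_mem_tile q)

lemma measurableSet_tile (q : ℤ × ℤ) : MeasurableSet (tile q) :=
  (Complex.measurable_re measurableSet_Ico).inter (Complex.measurable_im measurableSet_Ico)

lemma iUnion_tile : ⋃ q, tile q = upperHalfPlaneSet := by
  refine Subset.antisymm (iUnion_subset tile_subset) fun z hz => ?_
  have hz' : 0 < z.im := hz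
  obtain ⟨j, hj⟩ := exists_mem_Ico_zpow hz' (one_lt_two (α := ℝ))
  have hs : 0 < (2 : ℝ) ^ j := by positivity
  refine mem_iUnion.2 ⟨(j, ⌊z.re / 2 ^ j⌋), ⟨?_, ?_⟩, ?_, ?_⟩
  · exact (le_div_iff₀ hs).1 (Int.floor_le _)
  · exact (div_lt_iff₀ hs).1 (Int.lt_floor_add_one _)
  · exact hj.1
  · have := hj.2
    rw [zpow_add_one₀ two_ne_zero, mul_comm] at this
    exact this

lemma exists_mem_tile {z : ℂ} (hz : z ∈ upperHalfPlaneSet) : ∃ q, z ∈ tile q :=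
  mem_iUnion.1 (iUnion_tile ▸ hz)

lemma pairwise_disjoint_tile : Pairwise (Function.onFun Disjoint tile) := by
  have h1 : ∀ q q' : ℤ × ℤ, ∀ z, z ∈ tile q → z ∈ tile q' → q.1 ≤ q'.1 := by
    intro q q' z hz hz'
    by_contra! hc
    have h2 : (2 : ℝ) ^ (q'.1 + 1) ≤ 2 ^ q.1 := zpow_le_zpow_right₀ one_le_two hc
    rw [zpow_add_one₀ two_ne_zero] at h2
    have h3 := hz.2.1
    have h4 := hz'.2.2
    unfold side at h3 h4
    linarith
  have h2 : ∀ q q' : ℤ × ℤ, ∀ z, z ∈ tile q → z ∈ tile q' → q.1 = q'.1 → q.2 ≤ q'.2 := by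
    intro q q' z hz hz' he
    have hs := side_pos q
    have h3 := hz.1.1
    have h4 := hz'.1.2
    rw [show side q' = side q by unfold side; rw [he]] at h4
    have h5 : (q.2 : ℝ) < q'.2 + 1 := lt_of_mul_lt_mul_right (h3.trans_lt h4) hs.le
    exact Int.lt_add_one_iff.1 (by exact_mod_cast h5)
  intro q q' hne
  refine disjoint_left.2 fun z hz hz' => hne ?_
  have he := le_antisymm (h1 q q' z hz hz') (h1 q' q z hz' hz)
  exact Prod.ext he (le_antisymm (h2 q q' z hz hz' he) (h2 q' q z hz' hz he.symm))

lemma norm_sub_le_of_mem_tile {q : ℤ × ℤ} {z w : ℂ} (hz : z ∈ tile q) (hw : w ∈ tile q) :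
    ‖z - w‖ ≤ 2 * side q := by
  have h1 : |(z - w).re| ≤ side q := by
    rw [Complex.sub_re, abs_le]
    constructor <;> linarith [hz.1.1, hz.1.2, hw.1.1, hw.1.2]
  have h2 : |(z - w).im| ≤ side q := by
    rw [Complex.sub_im, abs_le]
    constructor <;> linarith [hz.2.1, hz.2.2, hw.2.1, hw.2.2]
  linarith [Complex.norm_le_abs_re_add_abs_im (z - w)]

lemma rpow_le_two_rpow_mul {x y : ℝ} (hx : 0 < x) (hxy : x ≤ 2 * y) (hyx : y ≤ 2 * x) (r : ℝ) :
    x ^ r ≤ 2 ^ |r| * y ^ r := by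
  have hy : 0 < y := by linarith
  rcases le_total 0 r with hr | hr
  · rw [abs_of_nonneg hr, ← Real.mul_rpow zero_le_two hy.le]
    gcongr
  · rw [abs_of_nonpos hr, Real.rpow_neg zero_le_two, ← div_eq_inv_mul,
      le_div_iff₀ (by positivity), mul_comm, ← Real.mul_rpow zero_le_two hx.le]
    exact Real.rpow_le_rpow_of_nonpos hy hyx hr

lemma norm_sub_conj_le_of_mem_tile {q : ℤ × ℤ} {z z' w : ℂ} (hz : z ∈ tile q) (hz' : z' ∈ tile q)
    (hw : 0 < w.im) : ‖z - (starRingEnd ℂ) w‖ ≤ 3 * ‖z' - (starRingEnd ℂ) w‖ := by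
  have h1 : side q ≤ ‖z' - (starRingEnd ℂ) w‖ := by
    refine le_trans ?_ ((le_abs_self _).trans (Complex.abs_im_le_norm _))
    simp
    linarith [hz'.2.1]
  have h2 := norm_sub_le_of_mem_tile hz hz'
  have h3 := norm_add_le (z - z') (z' - (starRingEnd ℂ) w)
  rw [sub_add_sub_cancel] at h3
  linarith

/-- On a product of two tiles the kernel is constant up to a bounded factor. -/
lemma powKernel_le_of_mem_tile {α b : ℝ} (hb : 0 ≤ b) {q q' : ℤ × ℤ} {z z' w w' : ℂ}
    (hz : z ∈ tile q) (hz' : z' ∈ tile q) (hw : w ∈ tile q') (hw' : w' ∈ tile q') :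
    powKernel α b 0 z w ≤ 9 ^ b * 2 ^ |b - 2 - α| * powKernel α b 0 z' w' := by
  have hz0 : 0 < z.im := tile_subset q hz
  have hz0' : 0 < z'.im := tile_subset q hz'
  have hw0 : 0 < w.im := tile_subset q' hw
  have hw0' : 0 < w'.im := tile_subset q' hw'
  have h1 : ‖z' - (starRingEnd ℂ) w'‖ ≤ 9 * ‖z - (starRingEnd ℂ) w‖ := by
    have h2 := norm_sub_conj_le_of_mem_tile hz' hz hw0'
    have h3 := norm_sub_conj_le_of_mem_tile hw' hw hz0
    rw [norm_sub_conj_comm w' z, norm_sub_conj_comm w z] at h3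
    linarith
  have h4 := rpow_le_two_rpow_mul hw0 (y := w'.im) (by linarith [hw.2.2, hw'.2.1])
    (by linarith [hw.2.1, hw'.2.2]) (b - 2 - α)
  have h5 := norm_sub_conj_pos hz0 hw0
  have h6 := norm_sub_conj_pos hz0' hw0'
  have h7 : ‖z' - (starRingEnd ℂ) w'‖ ^ b ≤ 9 ^ b * ‖z - (starRingEnd ℂ) w‖ ^ b := by
    rw [← Real.mul_rpow (by norm_num) h5.le]
    gcongr
  unfold powKernel
  rw [Real.rpow_zero, Real.rpow_zero, one_mul, one_mul, sub_zero, ← mul_div_assoc,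
    div_le_div_iff₀ (by positivity) (by positivity)]
  calc w.im ^ (b - 2 - α) * ‖z' - (starRingEnd ℂ) w'‖ ^ b
      ≤ (2 ^ |b - 2 - α| * w'.im ^ (b - 2 - α)) * (9 ^ b * ‖z - (starRingEnd ℂ) w‖ ^ b) := by
        gcongr
    _ = _ := by ring

lemma volume_tile (q : ℤ × ℤ) : volume (tile q) = ENNReal.ofReal (side q ^ 2) := by
  have h1 : tile q = Complex.measurableEquivRealProd ⁻¹'
      (Ico (q.2 * side q) ((q.2 + 1) * side q) ×ˢ Ico (side q) (2 * side q)) := rfl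
  have := side_pos q
  rw [h1, Complex.volume_preserving_equiv_real_prod.measure_preimage
    (measurableSet_Ico.prod measurableSet_Ico).nullMeasurableSet, Measure.volume_eq_prod,
    Measure.prod_prod, Real.volume_Ico, Real.volume_Ico, ← ENNReal.ofReal_mul (by linarith)]
  congr 1; ring

lemma V_apply_of_subset (α : ℝ) {s : Set ℂ} (hs : MeasurableSet s) (h : s ⊆ upperHalfPlaneSet) :
    V α s = ∫⁻ z in s, ENNReal.ofReal (z.im ^ α) := by
  rw [V, withDensity_apply _ hs, Measure.restrict_restrict hs, inter_eq_left.2 h]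

lemma V_tile_le (α : ℝ) (q : ℤ × ℤ) :
    V α (tile q) ≤ ENNReal.ofReal (2 ^ |α| * side q ^ (2 + α)) := by
  have hs := side_pos q
  rw [V_apply_of_subset α (measurableSet_tile q) (tile_subset q)]
  calc ∫⁻ z in tile q, ENNReal.ofReal (z.im ^ α)
      ≤ ∫⁻ _ in tile q, ENNReal.ofReal (2 ^ |α| * side q ^ α) := by
        refine setLIntegral_mono measurable_const fun z hz => ENNReal.ofReal_le_ofReal ?_
        exact rpow_le_two_rpow_mul (hs.trans_le hz.2.1) hz.2.2.le (by linarith [hz.2.1]) α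
    _ = _ := by
        rw [setLIntegral_const, volume_tile, ← ENNReal.ofReal_mul (by positivity),
          Real.rpow_add hs, Real.rpow_two]
        congr 1; ring

lemma le_V_tile (α : ℝ) (q : ℤ × ℤ) :
    ENNReal.ofReal (side q ^ (2 + α)) ≤ ENNReal.ofReal (2 ^ |α|) * V α (tile q) := by
  have hs := side_pos q
  rw [V_apply_of_subset α (measurableSet_tile q) (tile_subset q),
    ← lintegral_const_mul' _ _ ENNReal.ofReal_ne_top]
  calc ENNReal.ofReal (side q ^ (2 + α)) = ∫⁻ _ in tile q, ENNReal.ofReal (side q ^ α) := by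
        rw [setLIntegral_const, volume_tile, ← ENNReal.ofReal_mul (by positivity),
          Real.rpow_add hs, Real.rpow_two]
        congr 1; ring
    _ ≤ _ := by
        refine setLIntegral_mono (by fun_prop) fun z hz => ?_
        rw [← ENNReal.ofReal_mul (by positivity)]
        refine ENNReal.ofReal_le_ofReal ?_
        exact rpow_le_two_rpow_mul hs (by linarith [hz.2.1]) hz.2.2.le α

lemma V_tile_ne_top (α : ℝ) (q : ℤ × ℤ) : V α (tile q) ≠ ∞ :=
  ((V_tile_le α q).trans_lt ENNReal.ofReal_lt_top).ne

lemma V_tile_ne_zero (α : ℝ) (q : ℤ × ℤ) : V α (tile q) ≠ 0 := by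
  intro h
  have h1 := le_V_tile α q
  rw [h, mul_zero, nonpos_iff_eq_zero, ENNReal.ofReal_eq_zero] at h1
  have := Real.rpow_pos_of_pos (side_pos q) (2 + α)
  linarith

lemma lintegral_eq_tsum_tile {ν : Measure ℂ} (hν : ν upperHalfPlaneSetᶜ = 0) (f : ℂ → ℝ≥0∞) :
    ∫⁻ z, f z ∂ν = ∑' q, ∫⁻ z in tile q, f z ∂ν := by
  rw [← lintegral_iUnion measurableSet_tile pairwise_disjoint_tile, iUnion_tile,
    Measure.restrict_eq_self_of_ae_mem (s := upperHalfPlaneSet) (mem_ae_iff.2 hν)]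

lemma V_compl (α : ℝ) : V α upperHalfPlaneSetᶜ = 0 := mem_ae_iff.1 (ae_V_mem α)

/-! ### Mean values and the Berezin transform on tiles -/

/-- The value of an analytic function at a point of a tile is controlled by the Bergman-type
integral of its modulus at any other point of the same tile. -/
lemma exists_mean_value_bound (α : ℝ) {b : ℝ} (hb : 0 ≤ b) :
    ∃ c : ℝ, 0 < c ∧ ∀ F : ℂ → ℂ, DifferentiableOn ℂ F upperHalfPlaneSet →
      ∀ q, ∀ z ∈ tile q, ∀ w ∈ tile q, ENNReal.ofReal (c * ‖F w‖) ≤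
        ∫⁻ ζ, ENNReal.ofReal
          (powKernel α b 0 z ζ * upperHalfPlaneSet.indicator (fun ζ => ‖F ζ‖) ζ) ∂V α := by
  have hπ := Real.pi_pos
  set D : ℝ := 2 ^ |α| * 2 ^ |b - 2 - α| * 5 ^ b with hD
  have hD0 : 0 < D := by positivity
  refine ⟨Real.pi / (4 * D), by positivity, fun F hF q z hz w hw => ?_⟩
  have hv : 0 < w.im := tile_subset q hw
  set v := w.im with hv_def
  have him : ∀ ζ ∈ Metric.ball w (v / 2), |ζ.im - v| < v / 2 := fun ζ hζ => by
    rw [mem_ball_iff_norm] at hζ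
    exact (Complex.abs_im_le_norm (ζ - w)).trans_lt hζ
  have hsub : Metric.ball w (v / 2) ⊆ upperHalfPlaneSet := fun ζ hζ => by
    have := (abs_lt.1 (him ζ hζ)).1
    change 0 < ζ.im
    linarith
  have hkey : ∀ ζ ∈ Metric.ball w (v / 2),
      (v ^ 2)⁻¹ ≤ D * (ζ.im ^ α * powKernel α b 0 z ζ) := by
    intro ζ hζ
    have hζ0 : 0 < ζ.im := hsub hζ
    have h1 := abs_lt.1 (him ζ hζ)
    have h2 := rpow_le_two_rpow_mul hv (y := ζ.im) (by linarith) (by linarith) α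
    have h3 := rpow_le_two_rpow_mul hv (y := ζ.im) (by linarith) (by linarith) (b - 2 - α)
    have h4 : ‖z - (starRingEnd ℂ) ζ‖ ≤ 5 * v := by
      have h5 : ‖w - (starRingEnd ℂ) w‖ = 2 * v := by
        rw [norm_sub_conj, sub_self, ← two_mul, ← hv_def, zero_pow two_ne_zero, zero_add,
          Real.sqrt_sq (by positivity)]
      have h6 : ‖(starRingEnd ℂ) w - (starRingEnd ℂ) ζ‖ < v / 2 := by
        rw [← map_sub, Complex.norm_conj, ← mem_ball_iff_norm']
        exact hζ
      have h7 := norm_sub_le_of_mem_tile hz hw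
      have h8 : side q ≤ v := hw.2.1
      calc ‖z - (starRingEnd ℂ) ζ‖ = ‖(z - w) + (w - (starRingEnd ℂ) w) +
            ((starRingEnd ℂ) w - (starRingEnd ℂ) ζ)‖ := by congr 1; ring
        _ ≤ ‖z - w‖ + ‖w - (starRingEnd ℂ) w‖ + ‖(starRingEnd ℂ) w - (starRingEnd ℂ) ζ‖ :=
            norm_add₃_le
        _ ≤ 5 * v := by linarith
    have h9 := norm_sub_conj_pos (tile_subset q hz) hζ0
    have h10 : ‖z - (starRingEnd ℂ) ζ‖ ^ b ≤ 5 ^ b * v ^ b := by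
      rw [← Real.mul_rpow (by norm_num) hv.le]
      gcongr
    have h11 : v ^ α * v ^ (b - 2 - α) * v ^ 2 = v ^ b := by
      rw [← Real.rpow_two, ← Real.rpow_add hv, ← Real.rpow_add hv]
      congr 1; ring
    unfold powKernel
    rw [Real.rpow_zero, one_mul, sub_zero, inv_le_iff_one_le_mul₀ (by positivity),
      mul_div_assoc', mul_div_assoc', div_mul_eq_mul_div, one_le_div (by positivity)]
    calc ‖z - (starRingEnd ℂ) ζ‖ ^ b ≤ 5 ^ b * (v ^ α * v ^ (b - 2 - α) * v ^ 2) := by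
          rwa [h11]
      _ ≤ 5 ^ b * ((2 ^ |α| * ζ.im ^ α) * (2 ^ |b - 2 - α| * ζ.im ^ (b - 2 - α)) * v ^ 2) := by
          gcongr
      _ = _ := by rw [hD]; ring
  have h1 := enorm_le_lintegral_ball (half_pos hv) (hF.mono hsub)
  rw [lintegral_V]
  calc ENNReal.ofReal (Real.pi / (4 * D) * ‖F w‖)
      = ENNReal.ofReal ((D * v ^ 2)⁻¹) *
          (ENNReal.ofReal (Real.pi * (v / 2) ^ 2) * ‖F w‖ₑ) := by
        rw [← ofReal_norm, ← ENNReal.ofReal_mul (by positivity),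
          ← ENNReal.ofReal_mul (by positivity)]
        congr 1
        field_simp
        ring
    _ ≤ ENNReal.ofReal ((D * v ^ 2)⁻¹) * ∫⁻ ζ in Metric.ball w (v / 2), ‖F ζ‖ₑ := by gcongr
    _ = ∫⁻ ζ in Metric.ball w (v / 2), ENNReal.ofReal ((D * v ^ 2)⁻¹) * ‖F ζ‖ₑ :=
        (lintegral_const_mul' _ _ ENNReal.ofReal_ne_top).symm
    _ ≤ ∫⁻ ζ in Metric.ball w (v / 2), ENNReal.ofReal (ζ.im ^ α) * ENNReal.ofReal
          (powKernel α b 0 z ζ * upperHalfPlaneSet.indicator (fun ζ => ‖F ζ‖) ζ) := by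
        refine setLIntegral_mono' Metric.isOpen_ball.measurableSet fun ζ hζ => ?_
        have hζ0 : 0 < ζ.im := hsub hζ
        rw [indicator_of_mem (hsub hζ), ← ofReal_norm,
          ← ENNReal.ofReal_mul (by positivity), ← ENNReal.ofReal_mul (by positivity), ← mul_assoc]
        refine ENNReal.ofReal_le_ofReal (mul_le_mul_of_nonneg_right ?_ (norm_nonneg _))
        rw [mul_inv, inv_mul_le_iff₀ hD0]
        exact hkey ζ hζ
    _ ≤ _ := lintegral_mono_set hsub

lemma berezin_eq_lintegral_powKernel (α : ℝ) (μ : Measure ℂ) (z : ℂ) :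
    berezin α μ z = ∫⁻ w, ENNReal.ofReal (powKernel α (2 * (2 + α)) 0 w z) ∂μ := by
  unfold berezin powKernel
  refine lintegral_congr fun w => ?_
  rw [Real.rpow_zero, one_mul]
  congr 3; ring

lemma norm_sub_conj_le_side {q : ℤ × ℤ} {z w : ℂ} (hz : z ∈ tile q) (hw : w ∈ tile q) :
    ‖z - (starRingEnd ℂ) w‖ ≤ 6 * side q := by
  have h1 : ‖w - (starRingEnd ℂ) w‖ = 2 * w.im := by
    have : 0 < w.im := tile_subset q hw
    rw [norm_sub_conj, sub_self, ← two_mul, zero_pow two_ne_zero, zero_add,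
      Real.sqrt_sq (by positivity)]
  have h2 := norm_sub_le_of_mem_tile hz hw
  have h3 := norm_sub_le_norm_sub_add_norm_sub z w ((starRingEnd ℂ) w)
  linarith [hw.2.2]

lemma exists_measure_tile_le {α : ℝ} (hα : -1 < α) (μ : Measure ℂ) :
    ∃ C : ℝ, 0 < C ∧ ∀ q, ∀ z ∈ tile q,
      μ (tile q) ≤ ENNReal.ofReal C * V α (tile q) * berezin α μ z := by
  refine ⟨6 ^ (2 * (2 + α)) * 2 ^ |α|, by positivity, fun q z hz => ?_⟩
  have hs := side_pos q
  have hz0 : 0 < z.im := tile_subset q hz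
  have h1 : ∀ w ∈ tile q, 1 ≤ ENNReal.ofReal (6 ^ (2 * (2 + α)) * side q ^ (2 + α)) *
      ENNReal.ofReal (powKernel α (2 * (2 + α)) 0 w z) := by
    intro w hw
    have hw0 : 0 < w.im := tile_subset q hw
    have h2 := norm_sub_conj_pos hw0 hz0
    rw [← ENNReal.ofReal_mul (by positivity), ← ENNReal.ofReal_one]
    refine ENNReal.ofReal_le_ofReal ?_
    rw [powKernel, Real.rpow_zero, one_mul, mul_div_assoc', one_le_div (by positivity),
      show 2 * (2 + α) - 2 - α - 0 = 2 + α by ring]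
    calc ‖w - (starRingEnd ℂ) z‖ ^ (2 * (2 + α)) ≤ (6 * side q) ^ (2 * (2 + α)) :=
          Real.rpow_le_rpow h2.le (norm_sub_conj_le_side hw hz) (by linarith)
      _ = 6 ^ (2 * (2 + α)) * side q ^ (2 + α) * side q ^ (2 + α) := by
          rw [Real.mul_rpow (by norm_num) hs.le, mul_assoc, ← Real.rpow_add hs]
          congr 2; ring
      _ ≤ 6 ^ (2 * (2 + α)) * side q ^ (2 + α) * z.im ^ (2 + α) := by
          gcongr
          · linarith
          · exact hz.2.1
  calc μ (tile q) = ∫⁻ _ in tile q, 1 ∂μ := by simp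
    _ ≤ ∫⁻ w in tile q, ENNReal.ofReal (6 ^ (2 * (2 + α)) * side q ^ (2 + α)) *
          ENNReal.ofReal (powKernel α (2 * (2 + α)) 0 w z) ∂μ :=
        setLIntegral_mono' (measurableSet_tile q) h1
    _ = ENNReal.ofReal (6 ^ (2 * (2 + α)) * side q ^ (2 + α)) *
          ∫⁻ w in tile q, ENNReal.ofReal (powKernel α (2 * (2 + α)) 0 w z) ∂μ :=
        lintegral_const_mul' _ _ ENNReal.ofReal_ne_top
    _ ≤ ENNReal.ofReal (6 ^ (2 * (2 + α)) * side q ^ (2 + α)) * berezin α μ z := by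
        rw [berezin_eq_lintegral_powKernel]
        gcongr
        exact Measure.restrict_le_self
    _ ≤ _ := by
        gcongr
        rw [ENNReal.ofReal_mul (by positivity), ENNReal.ofReal_mul (by positivity), mul_assoc]
        gcongr
        exact le_V_tile α q

lemma exists_berezin_le {α : ℝ} (hα : -1 < α) {μ : Measure ℂ} (hμ : μ upperHalfPlaneSetᶜ = 0) :
    ∃ C : ℝ, 0 < C ∧ ∀ q, ∀ z ∈ tile q, ∀ z' ∈ tile q,
      berezin α μ z ≤ ENNReal.ofReal C * berezin α μ z' := by
  refine ⟨9 ^ (2 * (2 + α)) * 2 ^ |2 * (2 + α) - 2 - α|, by positivity, fun q z hz z' hz' => ?_⟩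
  rw [berezin_eq_lintegral_powKernel, berezin_eq_lintegral_powKernel,
    ← lintegral_const_mul' _ _ ENNReal.ofReal_ne_top]
  have hae : ∀ᵐ w ∂μ, w ∈ upperHalfPlaneSet := mem_ae_iff.2 hμ
  refine lintegral_mono_ae ?_
  filter_upwards [hae] with w hw
  obtain ⟨q', hq'⟩ := exists_mem_tile hw
  rw [← ENNReal.ofReal_mul (by positivity)]
  exact ENNReal.ofReal_le_ofReal (powKernel_le_of_mem_tile (by linarith) hq' hq' hz hz')

/-! ### Luxemburg norms -/

section Luxemburg

variable {X : Type*} [MeasurableSpace X] {Φ : ℝ → ℝ≥0∞} {μ : Measure X} {f : X → ℂ}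

lemma luxNorm_le {r : ℝ} (hr : 0 < r) (h : ∫⁻ x, Φ (‖f x‖ / r) ∂μ ≤ 1) :
    luxNorm Φ μ f ≤ ENNReal.ofReal r :=
  iInf_le_of_le r (iInf_le_of_le hr (iInf_le_of_le h le_rfl))

lemma exists_of_luxNorm_lt {a : ℝ≥0∞} (h : luxNorm Φ μ f < a) :
    ∃ r : ℝ, 0 < r ∧ ∫⁻ x, Φ (‖f x‖ / r) ∂μ ≤ 1 ∧ ENNReal.ofReal r < a := by
  simp only [luxNorm, iInf_lt_iff] at h
  obtain ⟨r, h1, h2, h3⟩ := h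
  exact ⟨r, h1, h2, h3⟩

end Luxemburg

lemma monotoneOn_toENN {Φ : ℝ → ℝ} (h : MonotoneOn Φ (Ici 0)) : MonotoneOn (toENN Φ) (Ici 0) :=
  fun _ hs _ ht hst => ENNReal.ofReal_le_ofReal (h hs ht hst)

/-! ### Sufficiency of the condition on the Berezin transform -/

lemma ofReal_le_complementary (Ψ : ℝ → ℝ) (s : ℝ) {t : ℝ} (ht : 0 ≤ t) :
    ENNReal.ofReal (s * t - Ψ t) ≤ complementary Ψ s :=
  le_iSup₂_of_le t ht le_rfl

/-- Young's inequality. -/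
lemma ofReal_mul_le_add_complementary (Ψ : ℝ → ℝ) (s : ℝ) {t : ℝ} (ht : 0 ≤ t) :
    ENNReal.ofReal (s * t) ≤ ENNReal.ofReal (Ψ t) + complementary Ψ s := by
  calc ENNReal.ofReal (s * t) = ENNReal.ofReal (Ψ t + (s * t - Ψ t)) := by congr 1; ring
    _ ≤ ENNReal.ofReal (Ψ t) + ENNReal.ofReal (s * t - Ψ t) := ENNReal.ofReal_add_le
    _ ≤ _ := by gcongr; exact ofReal_le_complementary Ψ s ht

/-- The modular form of the embedding. On a tile `Q` the mean value inequality bounds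
`Φ₁(|G(w)|)` by a function `J(z)`, for all `w, z ∈ Q`, and Young's inequality bounds
`Φ₂(|G(w)|)` times the Berezin transform at `z`, which dominates `μ(Q)/V(Q)`. -/
lemma exists_modular_embedding {α : ℝ} (hα : -1 < α) {Φ₁ Φ₂ : ℝ → ℝ} (h₁ : IsYoungType Φ₁)
    (h₂ : ClassL Φ₂ ∨ ClassU Φ₂) {μ : Measure ℂ} (hμ : μ upperHalfPlaneSetᶜ = 0)
    (hfin : ∀ᵐ z ∂V α, berezin α μ z < ∞)
    (hmem : luxNorm (complementary (Φ₁ ∘ inverse Φ₂)) (V α)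
      (fun z => ((berezin α μ z).toReal : ℂ)) < ∞) :
    ∃ c : ℝ, 0 < c ∧ ∀ G : ℂ → ℂ, DifferentiableOn ℂ G upperHalfPlaneSet →
      ∫⁻ z, toENN Φ₁ ‖G z‖ ∂V α ≤ 1 → ∫⁻ z, toENN Φ₂ (c * ‖G z‖) ∂μ ≤ 1 := by
  set Ψ := Φ₁ ∘ inverse Φ₂ with hΨ
  obtain ⟨c₀, hc₀, hmv⟩ := exists_mean_value_bound α (b := α + 3) (by linarith)
  obtain ⟨C₁, hC₁, hmod⟩ := h₁.exists_modular_bound hα (b := α + 3) (by linarith)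
  obtain ⟨C₂, hC₂, htile⟩ := exists_measure_tile_le hα μ
  obtain ⟨r, hr, hr1, -⟩ := exists_of_luxNorm_lt hmem
  set K : ℝ := C₂ * r * (C₁ + 1) with hK
  have hK0 : 0 < K := by positivity
  obtain ⟨θ, hθ, hscale⟩ := exists_scale_of_class h₂ K⁻¹ (by positivity)
  refine ⟨θ * c₀, by positivity, fun G hG hG1 => ?_⟩
  set m : ℂ → ℝ := upperHalfPlaneSet.indicator fun ζ => ‖G ζ‖ with hm
  have hm_meas : Measurable m :=
    measurable_indicator_of_continuousOn isOpen_upperHalfPlaneSet hG.continuousOn.norm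
  have hm0 : ∀ z, 0 ≤ m z := fun z => indicator_nonneg (fun _ _ => norm_nonneg _) z
  obtain ⟨J, hJm, hJ, hJint⟩ := hmod m hm_meas hm0
  have hmΦ : ∫⁻ w, ENNReal.ofReal (Φ₁ (m w)) ∂V α ≤ 1 := by
    refine le_trans (lintegral_mono_ae ?_) hG1
    filter_upwards [ae_V_mem α] with w hw
    have hmw : m w = ‖G w‖ := indicator_of_mem (s := upperHalfPlaneSet) hw _
    rw [hmw, toENN]
  set Φ₃ : ℂ → ℝ≥0∞ := fun z => complementary Ψ (‖((berezin α μ z).toReal : ℂ)‖ / r) with hΦ₃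
  set A : ℂ → ℝ≥0∞ := fun w => toENN Φ₂ (c₀ * ‖G w‖) with hA
  have hpt : ∀ q, ∀ z ∈ tile q, berezin α μ z < ∞ → ∀ w ∈ tile q,
      A w * berezin α μ z ≤ ENNReal.ofReal r * (J z + Φ₃ z) := by
    intro q z hz hzfin w hw
    have hx : 0 ≤ c₀ * ‖G w‖ := by positivity
    set s := Φ₂ (c₀ * ‖G w‖) with hs
    have hs0 : 0 ≤ s := by
      rw [← (growth_of_class h₂).map_zero]
      exact (growth_of_class h₂).monotoneOn self_mem_Ici hx hx
    have hΨs : Ψ s = Φ₁ (c₀ * ‖G w‖) := by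
      simp only [hΨ, Function.comp_apply, hs, inverse_map h₂ hx]
    set x := (berezin α μ z).toReal with hx_def
    have hx0 : 0 ≤ x := ENNReal.toReal_nonneg
    have h3 : berezin α μ z = ENNReal.ofReal r * ENNReal.ofReal (x / r) := by
      rw [← ENNReal.ofReal_mul hr.le, mul_div_cancel₀ _ hr.ne', ENNReal.ofReal_toReal hzfin.ne]
    rw [h3, mul_left_comm]
    gcongr
    simp only [hA, toENN, hΦ₃]
    rw [← hs, ← ENNReal.ofReal_mul hs0, mul_comm s, Complex.norm_real, Real.norm_of_nonneg hx0]
    refine (ofReal_mul_le_add_complementary Ψ _ hs0).trans ?_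
    gcongr
    rw [hΨs]
    exact hJ z (tile_subset q hz) _ hx (hmv G hG q z hz w hw)
  have hq : ∀ q, ∫⁻ w in tile q, A w ∂μ ≤
      ENNReal.ofReal (C₂ * r) * ∫⁻ z in tile q, (J z + Φ₃ z) ∂V α := by
    intro q
    have h4 : ∫⁻ w in tile q, A w ∂μ ≤ (⨆ w ∈ tile q, A w) * μ (tile q) := by
      rw [← setLIntegral_const]
      exact setLIntegral_mono' (measurableSet_tile q) fun w hw => le_iSup₂_of_le w hw le_rfl
    have h5 : ∀ z ∈ tile q, berezin α μ z < ∞ → ∫⁻ w in tile q, A w ∂μ ≤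
        V α (tile q) * (ENNReal.ofReal (C₂ * r) * (J z + Φ₃ z)) := by
      intro z hz hzfin
      calc ∫⁻ w in tile q, A w ∂μ
          ≤ (⨆ w ∈ tile q, A w) * (ENNReal.ofReal C₂ * V α (tile q) * berezin α μ z) :=
            h4.trans (mul_le_mul_right (htile q z hz) _)
        _ = (ENNReal.ofReal C₂ * V α (tile q)) * ⨆ w ∈ tile q, A w * berezin α μ z := by
            rw [mul_left_comm, ENNReal.iSup_mul]
            congr 2 with w
            rw [ENNReal.iSup_mul]
        _ ≤ (ENNReal.ofReal C₂ * V α (tile q)) * (ENNReal.ofReal r * (J z + Φ₃ z)) := by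
            gcongr
            exact iSup₂_le (hpt q z hz hzfin)
        _ = _ := by rw [ENNReal.ofReal_mul hC₂.le]; ring
    have h6 : V α (tile q) * ∫⁻ w in tile q, A w ∂μ ≤
        V α (tile q) * (ENNReal.ofReal (C₂ * r) * ∫⁻ z in tile q, (J z + Φ₃ z) ∂V α) := by
      calc V α (tile q) * ∫⁻ w in tile q, A w ∂μ
          = ∫⁻ _ in tile q, (∫⁻ w in tile q, A w ∂μ) ∂V α := by rw [setLIntegral_const, mul_comm]
        _ ≤ ∫⁻ z in tile q, V α (tile q) * (ENNReal.ofReal (C₂ * r) * (J z + Φ₃ z)) ∂V α := by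
            refine lintegral_mono_ae ?_
            filter_upwards [ae_restrict_mem (measurableSet_tile q), ae_restrict_of_ae hfin]
              with z hz hz'
            exact h5 z hz hz'
        _ = _ := by
            rw [lintegral_const_mul' _ _ (V_tile_ne_top α q),
              lintegral_const_mul' _ _ ENNReal.ofReal_ne_top]
    exact (ENNReal.mul_le_mul_iff_right (V_tile_ne_zero α q) (V_tile_ne_top α q)).1 h6
  have hAint : ∫⁻ w, A w ∂μ ≤ ENNReal.ofReal K := by
    rw [lintegral_eq_tsum_tile hμ]
    calc ∑' q, ∫⁻ w in tile q, A w ∂μ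
        ≤ ∑' q, ENNReal.ofReal (C₂ * r) * ∫⁻ z in tile q, (J z + Φ₃ z) ∂V α :=
          ENNReal.tsum_le_tsum hq
      _ = ENNReal.ofReal (C₂ * r) * (∫⁻ z, J z ∂V α + ∫⁻ z, Φ₃ z ∂V α) := by
          rw [ENNReal.tsum_mul_left, ← lintegral_eq_tsum_tile (V_compl α), lintegral_add_left hJm]
      _ ≤ ENNReal.ofReal (C₂ * r) * (ENNReal.ofReal C₁ * 1 + 1) := by
          gcongr
          exact hJint.trans (mul_le_mul_right hmΦ _)
      _ = ENNReal.ofReal K := by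
          rw [hK, ENNReal.ofReal_mul (p := C₂ * r) (by positivity),
            ENNReal.ofReal_add hC₁.le zero_le_one, ENNReal.ofReal_one, mul_one]
  calc ∫⁻ z, toENN Φ₂ (θ * c₀ * ‖G z‖) ∂μ ≤ ∫⁻ z, ENNReal.ofReal K⁻¹ * A z ∂μ := by
        refine lintegral_mono fun z => ?_
        simp only [hA, toENN]
        rw [← ENNReal.ofReal_mul (by positivity), mul_assoc]
        exact ENNReal.ofReal_le_ofReal (hscale _ (by positivity))
    _ = ENNReal.ofReal K⁻¹ * ∫⁻ z, A z ∂μ := lintegral_const_mul' _ _ ENNReal.ofReal_ne_top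
    _ ≤ ENNReal.ofReal K⁻¹ * ENNReal.ofReal K := by gcongr
    _ = 1 := by
        rw [← ENNReal.ofReal_mul (by positivity), inv_mul_cancel₀ hK0.ne', ENNReal.ofReal_one]

theorem embedding_of_berezin {α : ℝ} (hα : -1 < α) {Φ₁ Φ₂ : ℝ → ℝ} (h₁ : IsYoungType Φ₁)
    (h₂ : ClassL Φ₂ ∨ ClassU Φ₂) {μ : Measure ℂ} (hμ : μ upperHalfPlaneSetᶜ = 0)
    (hfin : ∀ᵐ z ∂V α, berezin α μ z < ∞)
    (hmem : luxNorm (complementary (Φ₁ ∘ inverse Φ₂)) (V α)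
      (fun z => ((berezin α μ z).toReal : ℂ)) < ∞) :
    ∃ C : ℝ, 0 < C ∧ ∀ F ∈ bergmanOrlicz α Φ₁, MemOrlicz (toENN Φ₂) μ F ∧
      luxNorm (toENN Φ₂) μ F ≤ ENNReal.ofReal C * luxNorm (toENN Φ₁) (V α) F := by
  obtain ⟨c, hc, hmod⟩ := exists_modular_embedding hα h₁ h₂ hμ hfin hmem
  refine ⟨c⁻¹, by positivity, fun F hF => ?_⟩
  have hle : luxNorm (toENN Φ₂) μ F ≤ ENNReal.ofReal c⁻¹ * luxNorm (toENN Φ₁) (V α) F := by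
    by_contra! hlt
    rw [mul_comm] at hlt
    have hlt' : luxNorm (toENN Φ₁) (V α) F < luxNorm (toENN Φ₂) μ F / ENNReal.ofReal c⁻¹ :=
      (ENNReal.lt_div_iff_mul_lt (Or.inl (by simpa using hc))
        (Or.inl ENNReal.ofReal_ne_top)).2 hlt
    obtain ⟨r, hr, hr1, hr2⟩ := exists_of_luxNorm_lt hlt'
    rw [ENNReal.lt_div_iff_mul_lt (Or.inl (by simpa using hc))
      (Or.inl ENNReal.ofReal_ne_top), ← ENNReal.ofReal_mul hr.le] at hr2
    refine hr2.not_ge (luxNorm_le (by positivity) ?_)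
    have h3 := hmod (fun z => F z / r) (hF.1.div_const _) (by
      simpa [Real.norm_of_nonneg hr.le] using hr1)
    refine le_trans (lintegral_mono fun z => le_of_eq ?_) h3
    congr 1
    rw [norm_div, Complex.norm_real, Real.norm_of_nonneg hr.le]
    field_simp
  refine ⟨⟨?_, hle.trans_lt (ENNReal.mul_lt_top ENNReal.ofReal_lt_top hF.2.2)⟩, hle⟩
  have h4 := hF.1.continuousOn.aestronglyMeasurable (μ := μ) measurableSet_upperHalfPlaneSet
  rwa [Measure.restrict_eq_self_of_ae_mem (s := upperHalfPlaneSet) (mem_ae_iff.2 hμ)] at h4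

/-! ### Necessity of the condition on the Berezin transform -/

/-- The modular inequality for step functions on the tiles. -/
lemma IsYoungType.exists_discrete_modular_bound {Φ : ℝ → ℝ} (h : IsYoungType Φ) {α b : ℝ}
    (hα : -1 < α) (hb : α + 2 < b) :
    ∃ C : ℝ, 0 < C ∧ ∀ (S : Finset (ℤ × ℤ)) (a : ℤ × ℤ → ℝ), (∀ q, 0 ≤ a q) →
      ∃ J : ℂ → ℝ≥0∞, Measurable J ∧
      (∀ z ∈ upperHalfPlaneSet, ∀ t : ℝ, 0 ≤ t →
        ENNReal.ofReal t ≤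
          ∑ q ∈ S, ENNReal.ofReal (a q * powKernel α b 0 z (corner q)) * V α (tile q) →
        ENNReal.ofReal (Φ t) ≤ J z) ∧
      ∫⁻ z, J z ∂V α ≤
        ENNReal.ofReal C * ∑ q ∈ S, ENNReal.ofReal (Φ (a q)) * V α (tile q) := by
  classical
  obtain ⟨C, hC, hmod⟩ := h.exists_modular_bound hα hb
  set D : ℝ := 9 ^ b * 2 ^ |b - 2 - α| with hD
  have hD0 : 0 < D := by positivity
  obtain ⟨C', hC', hΦD⟩ := h.exists_map_mul_le_const D hD0.le
  refine ⟨C' * C, by positivity, fun S a ha => ?_⟩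
  set m : ℂ → ℝ := fun z => ∑ q ∈ S, (tile q).indicator (fun _ => a q) z with hm
  have hm_meas : Measurable m :=
    Finset.measurable_fun_sum S fun q _ => measurable_const.indicator (measurableSet_tile q)
  have hm0 : ∀ z, 0 ≤ m z := fun z =>
    Finset.sum_nonneg fun q _ => indicator_nonneg (fun _ _ => ha q) z
  have hmq : ∀ q, ∀ z ∈ tile q, m z = if q ∈ S then a q else 0 := by
    intro q z hz
    have h1 : ∀ q' ∈ S, (tile q').indicator (fun _ => a q') z = if q = q' then a q' else 0 := by
      intro q' _
      split_ifs with heq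
      · rw [← heq, indicator_of_mem hz]
      · exact indicator_of_notMem (disjoint_left.1 (pairwise_disjoint_tile heq) hz) _
    simp only [hm]
    rw [Finset.sum_congr rfl h1, Finset.sum_ite_eq]
  obtain ⟨J, hJm, hJ, hJint⟩ := hmod m hm_meas hm0
  refine ⟨fun z => ENNReal.ofReal C' * J z, hJm.const_mul _, fun z hz t ht hsum => ?_, ?_⟩
  · obtain ⟨q₀, hq₀⟩ := exists_mem_tile hz
    have h2 : ENNReal.ofReal (D⁻¹ * t) ≤
        ∫⁻ w, ENNReal.ofReal (powKernel α b 0 z w * m w) ∂V α := by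
      rw [ENNReal.ofReal_mul (by positivity), lintegral_eq_tsum_tile (V_compl α)]
      calc ENNReal.ofReal D⁻¹ * ENNReal.ofReal t
          ≤ ENNReal.ofReal D⁻¹ *
            ∑ q ∈ S, ENNReal.ofReal (a q * powKernel α b 0 z (corner q)) * V α (tile q) := by
              gcongr
        _ = ∑ q ∈ S, ∫⁻ _ in tile q,
              ENNReal.ofReal (D⁻¹ * (a q * powKernel α b 0 z (corner q))) ∂V α := by
            rw [Finset.mul_sum]
            refine Finset.sum_congr rfl fun q _ => ?_
            rw [setLIntegral_const, ENNReal.ofReal_mul (p := D⁻¹) (by positivity), mul_assoc]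
        _ ≤ ∑ q ∈ S, ∫⁻ w in tile q, ENNReal.ofReal (powKernel α b 0 z w * m w) ∂V α := by
            refine Finset.sum_le_sum fun q hq => setLIntegral_mono' (measurableSet_tile q)
              fun w hw => ENNReal.ofReal_le_ofReal ?_
            rw [hmq q w hw, if_pos hq, inv_mul_le_iff₀ hD0]
            have h3 := powKernel_le_of_mem_tile (α := α) (b := b) (by linarith) hq₀ hq₀
              (corner_mem_tile q) hw
            calc a q * powKernel α b 0 z (corner q) ≤ a q * (D * powKernel α b 0 z w) :=
                  mul_le_mul_of_nonneg_left h3 (ha q)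
              _ = _ := by ring
        _ ≤ _ := ENNReal.sum_le_tsum S
    have h4 := hJ z hz _ (by positivity) h2
    have h5 := hΦD (D⁻¹ * t) (by positivity)
    rw [mul_inv_cancel_left₀ hD0.ne'] at h5
    calc ENNReal.ofReal (Φ t) ≤ ENNReal.ofReal C' * ENNReal.ofReal (Φ (D⁻¹ * t)) := by
          rw [← ENNReal.ofReal_mul hC'.le]
          exact ENNReal.ofReal_le_ofReal h5
      _ ≤ _ := mul_le_mul_right h4 _
  · rw [lintegral_const_mul _ hJm, ENNReal.ofReal_mul hC'.le, mul_assoc]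
    gcongr
    refine hJint.trans_eq ?_
    congr 1
    rw [lintegral_eq_tsum_tile (V_compl α), tsum_eq_sum (s := S)]
    · refine Finset.sum_congr rfl fun q hq => ?_
      rw [← setLIntegral_const]
      refine setLIntegral_congr_fun (measurableSet_tile q) fun w hw => ?_
      simp only [hmq q w hw, if_pos hq]
    · intro q hq
      rw [setLIntegral_congr_fun (g := fun _ => 0) (measurableSet_tile q) fun w hw => by
        simp [hmq q w hw, if_neg hq, h.map_zero]]
      simp

/-- The sum over all choices of signs, encoded as functions with values in the units of `ℤ`. For
each choice, flipping the sign of `x i` gives two sums whose difference is `± 2 x i`, so one of them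
has modulus at least `|x i|`. This replaces Khinchine's inequality, and needs no property of `φ`
besides monotonicity. -/
lemma card_mul_le_sum_signs {ι : Type*} [Fintype ι] [DecidableEq ι] (x : ι → ℂ) (i : ι)
    {φ : ℝ → ℝ≥0∞} (hφ : MonotoneOn φ (Ici 0)) :
    (Fintype.card (ι → ℤˣ) : ℝ≥0∞) * φ ‖x i‖ ≤
      2 * ∑ ε : ι → ℤˣ, φ ‖∑ j, ((ε j : ℤ) : ℂ) * x j‖ := by
  set T : (ι → ℤˣ) → ℂ := fun ε => ∑ j, ((ε j : ℤ) : ℂ) * x j with hT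
  set flip : (ι → ℤˣ) ≃ (ι → ℤˣ) := Equiv.mulLeft (Pi.mulSingle i (-1)) with hflip
  have hdiff : ∀ ε, T ε - T (flip ε) = 2 * (((ε i : ℤ) : ℂ) * x i) := by
    intro ε
    simp only [hT, ← Finset.sum_sub_distrib]
    rw [Finset.sum_eq_single i]
    · simp [hflip]; ring
    · intro j _ hj
      simp [hflip, Pi.mulSingle_eq_of_ne hj]
    · simp
  have hle : ∀ ε, φ ‖x i‖ ≤ φ ‖T ε‖ + φ ‖T (flip ε)‖ := by
    intro ε
    have h1 : ‖T ε - T (flip ε)‖ = 2 * ‖x i‖ := by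
      rw [hdiff]
      rcases Int.units_eq_one_or (ε i) with h | h <;> simp [h]
    have h2 := norm_sub_le (T ε) (T (flip ε))
    rcases le_total ‖T ε‖ ‖T (flip ε)‖ with h3 | h3
    · exact (hφ (norm_nonneg _) (norm_nonneg _) (by linarith)).trans le_add_self
    · exact (hφ (norm_nonneg _) (norm_nonneg _) (by linarith)).trans le_self_add
  calc (Fintype.card (ι → ℤˣ) : ℝ≥0∞) * φ ‖x i‖ = ∑ _ε : ι → ℤˣ, φ ‖x i‖ := by
        simp [Finset.card_univ]
    _ ≤ ∑ ε, (φ ‖T ε‖ + φ ‖T (flip ε)‖) := Finset.sum_le_sum fun ε _ => hle ε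
    _ = ∑ ε, φ ‖T ε‖ + ∑ ε, φ ‖T ε‖ := by
        rw [Finset.sum_add_distrib, Equiv.sum_comp flip fun ε => φ ‖T ε‖]
    _ = _ := (two_mul _).symm

/-- Testing the embedding on the functions `∑ ± a_Q (v_Q / (z - w̄_Q))^n`, where `w_Q` is the corner
of the tile `Q` and `v_Q = Im w_Q`, and averaging over the signs. -/
lemma exists_tile_bound {α : ℝ} (hα : -1 < α) {Φ₁ Φ₂ : ℝ → ℝ} (h₁ : IsYoungType Φ₁)
    (h₂ : ClassL Φ₂ ∨ ClassU Φ₂) {μ : Measure ℂ} (hμ : μ upperHalfPlaneSetᶜ = 0)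
    (hemb : ∃ C : ℝ, 0 < C ∧ ∀ F ∈ bergmanOrlicz α Φ₁, MemOrlicz (toENN Φ₂) μ F ∧
      luxNorm (toENN Φ₂) μ F ≤ ENNReal.ofReal C * luxNorm (toENN Φ₁) (V α) F) :
    ∃ δ : ℝ, 0 < δ ∧ ∀ (S : Finset (ℤ × ℤ)) (s : ℤ × ℤ → ℝ), (∀ q, 0 ≤ s q) →
      ∑ q ∈ S, ENNReal.ofReal ((Φ₁ ∘ inverse Φ₂) (s q)) * V α (tile q) ≤ ENNReal.ofReal δ →
      ∑ q ∈ S, ENNReal.ofReal (s q) * μ (tile q) ≤ 2 := by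
  obtain ⟨C₀, hC₀, hemb⟩ := hemb
  obtain ⟨n, hn⟩ := exists_nat_gt (α + 2)
  obtain ⟨C, hC, hmod⟩ := h₁.exists_discrete_modular_bound hα hn
  set κ : ℝ := 2 ^ |α| with hκ
  have hκ0 : 0 < κ := by positivity
  set R : ℝ := 2 * C₀ * κ with hR
  have hR0 : 0 < R := by positivity
  obtain ⟨C₃, hC₃, hΦR⟩ := h₁.exists_map_mul_le_const (R * 6 ^ n) (by positivity)
  refine ⟨(C * C₃)⁻¹, by positivity, fun S s hs hsum => ?_⟩
  set a : ℤ × ℤ → ℝ := fun q => R * 6 ^ n * inverse Φ₂ (s q) with ha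
  have ha0 : ∀ q, 0 ≤ a q := fun q => mul_nonneg (by positivity) (inverse_nonneg h₂ (hs q))
  obtain ⟨J, -, hJ, hJint⟩ := hmod S a ha0
  have hJ1 : ∫⁻ z, J z ∂V α ≤ 1 := by
    calc ∫⁻ z, J z ∂V α ≤ ENNReal.ofReal C * ∑ q ∈ S, ENNReal.ofReal (Φ₁ (a q)) * V α (tile q) :=
          hJint
      _ ≤ ENNReal.ofReal C * ∑ q ∈ S, ENNReal.ofReal C₃ *
            (ENNReal.ofReal ((Φ₁ ∘ inverse Φ₂) (s q)) * V α (tile q)) := by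
          refine mul_le_mul_right (Finset.sum_le_sum fun q _ => ?_) _
          rw [← mul_assoc, ← ENNReal.ofReal_mul hC₃.le]
          refine mul_le_mul_left (ENNReal.ofReal_le_ofReal ?_) _
          exact hΦR _ (inverse_nonneg h₂ (hs q))
      _ ≤ ENNReal.ofReal C * (ENNReal.ofReal C₃ * ENNReal.ofReal (C * C₃)⁻¹) := by
          rw [← Finset.mul_sum]
          gcongr
      _ = 1 := by
          rw [← ENNReal.ofReal_mul hC₃.le, ← ENNReal.ofReal_mul hC.le, ← mul_assoc,
            mul_inv_cancel₀ (by positivity), ENNReal.ofReal_one]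
  set x : ℂ → S → ℂ := fun z q => a q * ((side q : ℂ) / (z - (starRingEnd ℂ) (corner q))) ^ n
    with hx
  set F : (S → ℤˣ) → ℂ → ℂ := fun ε z => ∑ q, ((ε q : ℤ) : ℂ) * x z q with hF
  have hxnorm : ∀ z, ∀ q : S, ‖x z q‖ =
      a q * (side q / ‖z - (starRingEnd ℂ) (corner q)‖) ^ n := by
    intro z q
    simp only [hx]
    rw [norm_mul, norm_pow, norm_div, Complex.norm_real, Complex.norm_real,
      Real.norm_of_nonneg (ha0 q), Real.norm_of_nonneg (side_pos q).le]
  have hFdiff : ∀ ε, DifferentiableOn ℂ (F ε) upperHalfPlaneSet := by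
    intro ε
    refine DifferentiableOn.fun_sum fun q _ => DifferentiableOn.const_mul
      (DifferentiableOn.const_mul (DifferentiableOn.pow ?_ _) _) _
    refine DifferentiableOn.div (by fun_prop) (by fun_prop) fun z hz => ?_
    exact norm_pos_iff.1 (norm_sub_conj_pos hz (corner_mem q))
  have hFmeas : ∀ ε, Measurable (F ε) := fun ε => by
    simp only [hF, hx]
    fun_prop
  have hFΦ : ∀ ε, ∀ z ∈ upperHalfPlaneSet, toENN Φ₁ (‖F ε z‖ / κ) ≤ J z := by
    intro ε z hz
    have hz0 : 0 < z.im := hz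
    refine hJ z hz _ (by positivity) ?_
    rw [div_eq_inv_mul, ENNReal.ofReal_mul (by positivity)]
    have h3 : ‖F ε z‖ ≤ ∑ q : S, a q * (side q / ‖z - (starRingEnd ℂ) (corner q)‖) ^ n := by
      refine (norm_sum_le _ _).trans_eq (Finset.sum_congr rfl fun q _ => ?_)
      rw [norm_mul, hxnorm]
      rcases Int.units_eq_one_or (ε q) with h | h <;> simp [h]
    have h4 : ∀ q, a q * (side q / ‖z - (starRingEnd ℂ) (corner q)‖) ^ n =
        a q * powKernel α n 0 z (corner q) * side q ^ (2 + α) := by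
      intro q
      rw [powKernel, Real.rpow_zero, one_mul, corner_im, div_pow, ← Real.rpow_natCast,
        ← Real.rpow_natCast, mul_assoc (a q), div_mul_eq_mul_div, ← Real.rpow_add (side_pos q)]
      congr 3; ring
    calc ENNReal.ofReal κ⁻¹ * ENNReal.ofReal ‖F ε z‖
        ≤ ENNReal.ofReal κ⁻¹ * ∑ q ∈ S, ENNReal.ofReal
            (a q * powKernel α n 0 z (corner q) * side q ^ (2 + α)) := by
          gcongr
          rw [← ENNReal.ofReal_sum_of_nonneg, ← Finset.sum_coe_sort S]
          · refine ENNReal.ofReal_le_ofReal (h3.trans_eq ?_)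
            exact Finset.sum_congr rfl fun q _ => h4 q
          · intro q _
            rw [← h4]
            have := ha0 q
            have := side_pos q
            positivity
      _ ≤ ENNReal.ofReal κ⁻¹ * ∑ q ∈ S, ENNReal.ofReal (a q * powKernel α n 0 z (corner q)) *
            (ENNReal.ofReal κ * V α (tile q)) := by
          gcongr with q hq
          rw [ENNReal.ofReal_mul (mul_nonneg (ha0 q)
            (powKernel_nonneg hz0.le (side_pos q).le))]
          gcongr
          exact le_V_tile α q
      _ = _ := by
          rw [Finset.mul_sum]
          refine Finset.sum_congr rfl fun q _ => ?_
          rw [mul_left_comm (ENNReal.ofReal (a q * _)), ← mul_assoc,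
            ← ENNReal.ofReal_mul (by positivity), inv_mul_cancel₀ hκ0.ne', ENNReal.ofReal_one,
            one_mul]
  have hφmono := monotoneOn_toENN (growth_of_class h₂).monotoneOn
  set φ : ℝ → ℝ≥0∞ := fun t => toENN Φ₂ (t / R) with hφ
  have hφm : MonotoneOn φ (Ici 0) := fun t ht t' ht' htt' =>
    hφmono (div_nonneg ht hR0.le) (div_nonneg ht' hR0.le) (by gcongr)
  have hFφ : ∀ ε, ∫⁻ z, φ ‖F ε z‖ ∂μ ≤ 1 := by
    intro ε
    have h5 : luxNorm (toENN Φ₁) (V α) (F ε) ≤ ENNReal.ofReal κ := by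
      refine luxNorm_le hκ0 (le_trans (lintegral_mono_ae ?_) hJ1)
      filter_upwards [ae_V_mem α] with z hz
      exact hFΦ ε z hz
    have h6 : F ε ∈ bergmanOrlicz α Φ₁ :=
      ⟨hFdiff ε, (hFmeas ε).aestronglyMeasurable, h5.trans_lt ENNReal.ofReal_lt_top⟩
    have h7 : luxNorm (toENN Φ₂) μ (F ε) < ENNReal.ofReal R := by
      refine (((hemb _ h6).2).trans (mul_le_mul_right h5 _)).trans_lt ?_
      rw [← ENNReal.ofReal_mul hC₀.le]
      refine (ENNReal.ofReal_lt_ofReal_iff hR0).2 ?_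
      have : 0 < C₀ * κ := by positivity
      rw [hR]; linarith
    obtain ⟨r, hr, hr1, hr2⟩ := exists_of_luxNorm_lt h7
    have hrR : r < R := (ENNReal.ofReal_lt_ofReal_iff hR0).1 hr2
    refine le_trans (lintegral_mono fun z => ?_) hr1
    exact hφmono (mem_Ici.2 (by positivity)) (mem_Ici.2 (by positivity)) (by gcongr)
  have hφmeas : ∀ ε, Measurable fun z => φ ‖F ε z‖ := fun ε => by
    refine (measurable_comp_of_monotoneOn (growth_of_class h₂).monotoneOn
      (m := fun z => ‖F ε z‖ / R) ?_ fun z => by positivity).ennreal_ofReal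
    exact (hFmeas ε).norm.div_const R
  set N : ℝ≥0∞ := (Fintype.card (S → ℤˣ) : ℝ≥0∞) with hN
  have hlow : ∀ q ∈ S, ∀ z ∈ tile q, N * ENNReal.ofReal (s q) ≤ 2 * ∑ ε, φ ‖F ε z‖ := by
    intro q hq z hz
    refine le_trans ?_ (card_mul_le_sum_signs (x z) ⟨q, hq⟩ hφm)
    gcongr
    have h8 : R * inverse Φ₂ (s q) ≤ ‖x z ⟨q, hq⟩‖ := by
      rw [hxnorm]
      have h9 := norm_sub_conj_le_side hz (corner_mem_tile q)
      have h10 : 0 < ‖z - (starRingEnd ℂ) (corner q)‖ :=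
        norm_sub_conj_pos (tile_subset q hz) (corner_mem q)
      have h11 : (1 / 6 : ℝ) ≤ side q / ‖z - (starRingEnd ℂ) (corner q)‖ := by
        rw [div_le_div_iff₀ (by norm_num) h10]
        linarith
      calc R * inverse Φ₂ (s q) = a q * (1 / 6) ^ n := by
            simp only [ha]
            rw [one_div, inv_pow]
            field_simp
        _ ≤ _ := by
            have := ha0 q
            gcongr
    have h12 : inverse Φ₂ (s q) ≤ ‖x z ⟨q, hq⟩‖ / R := by
      rw [le_div_iff₀ hR0, mul_comm]
      exact h8
    refine ENNReal.ofReal_le_ofReal ?_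
    conv_lhs => rw [← map_inverse h₂ (hs q)]
    exact (growth_of_class h₂).monotoneOn (inverse_nonneg h₂ (hs q)) (mem_Ici.2 (by positivity))
      h12
  have hN0 : N ≠ 0 := by simp [hN]
  have hNt : N ≠ ∞ := ENNReal.natCast_ne_top _
  refine (ENNReal.mul_le_mul_iff_right hN0 hNt).1 ?_
  calc N * ∑ q ∈ S, ENNReal.ofReal (s q) * μ (tile q)
      = ∑ q ∈ S, ∫⁻ _ in tile q, N * ENNReal.ofReal (s q) ∂μ := by
        rw [Finset.mul_sum]
        refine Finset.sum_congr rfl fun q _ => ?_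
        rw [setLIntegral_const, mul_assoc]
    _ ≤ ∑ q ∈ S, ∫⁻ z in tile q, 2 * ∑ ε, φ ‖F ε z‖ ∂μ :=
        Finset.sum_le_sum fun q hq => setLIntegral_mono' (measurableSet_tile q) (hlow q hq)
    _ ≤ ∫⁻ z, 2 * ∑ ε, φ ‖F ε z‖ ∂μ := by
        rw [lintegral_eq_tsum_tile hμ]
        exact ENNReal.sum_le_tsum S
    _ = 2 * ∑ ε, ∫⁻ z, φ ‖F ε z‖ ∂μ := by
        rw [lintegral_const_mul' _ _ ENNReal.ofNat_ne_top,
          lintegral_finsetSum _ fun ε _ => hφmeas ε]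
    _ ≤ 2 * ∑ _ε : S → ℤˣ, 1 := by
        gcongr with ε
        exact hFφ ε
    _ = N * 2 := by simp [hN, Finset.card_univ, mul_comm]

/-- The dual form of the embedding: the Berezin transform, sampled at the corners, acts as a bounded
functional on the step functions `∑ t_Q 1_Q` of bounded modular. By duality it is a matter of
applying `exists_tile_bound` to the coefficients of the image of this step function under the
adjoint of the Berezin transform. -/
lemma exists_sum_berezin_le {α : ℝ} (hα : -1 < α) {Ψ : ℝ → ℝ} (h : IsYoungType Ψ)
    {μ : Measure ℂ} (hμ : μ upperHalfPlaneSetᶜ = 0) {δ : ℝ} (hδ : 0 < δ)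
    (htile : ∀ (S : Finset (ℤ × ℤ)) (s : ℤ × ℤ → ℝ), (∀ q, 0 ≤ s q) →
      ∑ q ∈ S, ENNReal.ofReal (Ψ (s q)) * V α (tile q) ≤ ENNReal.ofReal δ →
      ∑ q ∈ S, ENNReal.ofReal (s q) * μ (tile q) ≤ 2) :
    ∃ δ' C : ℝ, 0 < δ' ∧ 0 < C ∧ ∀ (S : Finset (ℤ × ℤ)) (t : ℤ × ℤ → ℝ), (∀ q, 0 ≤ t q) →
      ∑ q ∈ S, ENNReal.ofReal (Ψ (t q)) * V α (tile q) ≤ ENNReal.ofReal δ' →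
      ∑ q ∈ S, ENNReal.ofReal (t q) * V α (tile q) * berezin α μ (corner q) ≤
        ENNReal.ofReal C := by
  set b : ℝ := 2 * (2 + α) with hb
  obtain ⟨C, hC, hmod⟩ := h.exists_discrete_modular_bound hα (b := b) (by linarith)
  set D : ℝ := 9 ^ b * 2 ^ |b - 2 - α| with hD
  have hD0 : 0 < D := by positivity
  refine ⟨C⁻¹ * δ, D * D * 2, by positivity, by positivity, fun S t ht hsum => ?_⟩
  obtain ⟨J, -, hJ, hJint⟩ := hmod S t ht
  set T : ℂ → ℝ≥0∞ := fun w =>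
    ∑ q ∈ S, ENNReal.ofReal (t q * powKernel α b 0 w (corner q)) * V α (tile q) with hT
  have hTfin : ∀ w, T w ≠ ∞ := fun w =>
    ENNReal.sum_ne_top.2 fun q _ => ENNReal.mul_ne_top ENNReal.ofReal_ne_top (V_tile_ne_top α q)
  have hTle : ∀ q', ∀ w ∈ tile q', ∀ w' ∈ tile q', T w ≤ ENNReal.ofReal D * T w' := by
    intro q' w hw w' hw'
    simp only [hT]
    rw [Finset.mul_sum]
    refine Finset.sum_le_sum fun q _ => ?_
    rw [← mul_assoc, ← ENNReal.ofReal_mul hD0.le]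
    gcongr ENNReal.ofReal ?_ * _
    calc t q * powKernel α b 0 w (corner q) ≤ t q * (D * powKernel α b 0 w' (corner q)) :=
          mul_le_mul_of_nonneg_left (powKernel_le_of_mem_tile (by linarith) hw hw'
            (corner_mem_tile q) (corner_mem_tile q)) (ht q)
      _ = _ := by ring
  set s : ℤ × ℤ → ℝ := fun q' => D⁻¹ * (T (corner q')).toReal with hs
  have hs0 : ∀ q', 0 ≤ s q' := fun q' => mul_nonneg (by positivity) ENNReal.toReal_nonneg
  have hsT : ∀ q', T (corner q') = ENNReal.ofReal D * ENNReal.ofReal (s q') := fun q' => by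
    rw [← ENNReal.ofReal_mul hD0.le, hs, mul_inv_cancel_left₀ hD0.ne',
      ENNReal.ofReal_toReal (hTfin _)]
  have hΨs : ∀ q', ∀ w ∈ tile q', ENNReal.ofReal (Ψ (s q')) ≤ J w := by
    intro q' w hw
    refine hJ w (tile_subset q' hw) _ (hs0 q') ?_
    have h1 := hTle q' _ (corner_mem_tile q') w hw
    rw [hsT] at h1
    exact (ENNReal.mul_le_mul_iff_right (by simpa using hD0) ENNReal.ofReal_ne_top).1 h1
  have hΨsum : ∀ S' : Finset (ℤ × ℤ),
      ∑ q ∈ S', ENNReal.ofReal (Ψ (s q)) * V α (tile q) ≤ ENNReal.ofReal δ := by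
    intro S'
    calc ∑ q ∈ S', ENNReal.ofReal (Ψ (s q)) * V α (tile q)
        ≤ ∑ q ∈ S', ∫⁻ w in tile q, J w ∂V α := by
          refine Finset.sum_le_sum fun q _ => ?_
          rw [← setLIntegral_const]
          exact setLIntegral_mono' (measurableSet_tile q) (hΨs q)
      _ ≤ ∫⁻ w, J w ∂V α := by
          rw [lintegral_eq_tsum_tile (V_compl α)]
          exact ENNReal.sum_le_tsum S'
      _ ≤ ENNReal.ofReal C * ENNReal.ofReal (C⁻¹ * δ) := hJint.trans (by gcongr)
      _ = ENNReal.ofReal δ := by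
          rw [← ENNReal.ofReal_mul hC.le, mul_inv_cancel_left₀ hC.ne']
  have hTint : ∑ q ∈ S, ENNReal.ofReal (t q) * V α (tile q) * berezin α μ (corner q) =
      ∫⁻ w, T w ∂μ := by
    have hk : ∀ q, Measurable fun w => ENNReal.ofReal (powKernel α b 0 w (corner q)) := fun q =>
      ((measurable_powKernel α b 0).comp measurable_prodMk_right).ennreal_ofReal
    have hT' : ∀ w, T w = ∑ q ∈ S, ENNReal.ofReal (t q) * V α (tile q) *
        ENNReal.ofReal (powKernel α b 0 w (corner q)) := by
      intro w
      refine Finset.sum_congr rfl fun q _ => ?_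
      rw [ENNReal.ofReal_mul (ht q)]
      ring
    rw [lintegral_congr hT', lintegral_finsetSum _ fun q _ => (hk q).const_mul _]
    refine Finset.sum_congr rfl fun q _ => ?_
    rw [lintegral_const_mul _ (hk q), berezin_eq_lintegral_powKernel]
  rw [hTint, lintegral_eq_tsum_tile hμ]
  calc ∑' q, ∫⁻ w in tile q, T w ∂μ
      ≤ ∑' q, ENNReal.ofReal (D * D) * (ENNReal.ofReal (s q) * μ (tile q)) := by
        refine ENNReal.tsum_le_tsum fun q => ?_
        calc ∫⁻ w in tile q, T w ∂μ
            ≤ ∫⁻ _ in tile q, ENNReal.ofReal D * T (corner q) ∂μ :=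
              setLIntegral_mono' (measurableSet_tile q) fun w hw =>
                hTle q w hw _ (corner_mem_tile q)
          _ = _ := by
              rw [setLIntegral_const, hsT, ENNReal.ofReal_mul hD0.le]
              ring
    _ = ENNReal.ofReal (D * D) * ∑' q, ENNReal.ofReal (s q) * μ (tile q) := ENNReal.tsum_mul_left
    _ ≤ ENNReal.ofReal (D * D) * 2 := by
        gcongr
        rw [ENNReal.tsum_eq_iSup_sum]
        exact iSup_le fun S' => htile S' s hs0 (hΨsum S')
    _ = ENNReal.ofReal (D * D * 2) := by
        rw [ENNReal.ofReal_mul (p := D * D) (by positivity), ENNReal.ofReal_ofNat]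

lemma complementary_mono {Ψ : ℝ → ℝ} {s s' : ℝ} (h : s ≤ s') :
    complementary Ψ s ≤ complementary Ψ s' :=
  iSup₂_mono fun _ ht => ENNReal.ofReal_le_ofReal
    (sub_le_sub_right (mul_le_mul_of_nonneg_right h ht) _)

lemma sum_iSup_le {ι κ : Type*} [Nonempty κ] {S : Finset ι} {g : ι → κ → ℝ≥0∞} {B : ℝ≥0∞}
    (h : ∀ t : ι → κ, ∑ i ∈ S, g i (t i) ≤ B) : ∑ i ∈ S, ⨆ k, g i k ≤ B := by
  classical
  have h1 : ∀ i, ⨆ k, g i k = ⨆ t : ι → κ, g i (t i) := fun i =>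
    ((Function.surjective_eval (β := fun _ : ι => κ) i).iSup_comp (g i)).symm
  simp_rw [h1]
  rw [ENNReal.finsetSum_iSup fun t t' =>
    ⟨fun i => if g i (t i) ≤ g i (t' i) then t' i else t i, fun i => ?_⟩]
  · exact iSup_le h
  · dsimp only
    split_ifs with hle
    · exact ⟨hle, le_rfl⟩
    · exact ⟨le_rfl, (not_le.1 hle).le⟩

/-- Passage from a bounded functional on a modular ball to the modular of the complementary
function. A family `t` with `∑ Ψ(t_i) v_i > δ` is first scaled down to the ball; this costs a factor
which, by `Ψ(θ t) ≤ θ Ψ(t)`, is compensated by the term `∑ Ψ(t_i) v_i`. -/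
lemma IsYoungType.sum_complementary_le {Ψ : ℝ → ℝ} (h : IsYoungType Ψ) {ι : Type*}
    {v β : ι → ℝ} (hv : ∀ i, 0 ≤ v i) {δ C : ℝ} (hδ : 0 < δ) {S : Finset ι}
    (hS : ∀ t : ι → ℝ, (∀ i, 0 ≤ t i) → ∑ i ∈ S, Ψ (t i) * v i ≤ δ →
      ∑ i ∈ S, t i * v i * β i ≤ C) {η : ℝ} (hη : 0 ≤ η) (hηδ : η * C ≤ δ) (hη1 : η * C ≤ 1) :
    ∑ i ∈ S, complementary Ψ (η * β i) * ENNReal.ofReal (v i) ≤ 1 := by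
  classical
  have key : ∀ t : ι → ℝ, (∀ i, 0 ≤ t i) →
      ∑ i ∈ S, (η * β i * t i - Ψ (t i)) * v i ≤ 1 := by
    intro t ht
    set A := ∑ i ∈ S, Ψ (t i) * v i with hA
    have h1 : ∑ i ∈ S, (η * β i * t i - Ψ (t i)) * v i =
        η * ∑ i ∈ S, t i * v i * β i - A := by
      rw [hA, Finset.mul_sum, ← Finset.sum_sub_distrib]
      exact Finset.sum_congr rfl fun i _ => by ring
    rw [h1]
    have hA0 : 0 ≤ A := Finset.sum_nonneg fun i _ => mul_nonneg (h.nonneg (ht i)) (hv i)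
    rcases le_or_gt A δ with hAδ | hAδ
    · have := mul_le_mul_of_nonneg_left (hS t ht hAδ) hη
      linarith
    · have hA1 : 0 < A := hδ.trans hAδ
      have hθ0 : 0 < δ / A := by positivity
      have hθ1 : δ / A ≤ 1 := (div_le_one hA1).2 hAδ.le
      have h2 : ∑ i ∈ S, Ψ (δ / A * t i) * v i ≤ δ := by
        calc ∑ i ∈ S, Ψ (δ / A * t i) * v i ≤ ∑ i ∈ S, δ / A * (Ψ (t i) * v i) := by
              refine Finset.sum_le_sum fun i _ => ?_
              rw [← mul_assoc]
              exact mul_le_mul_of_nonneg_right (h.map_mul_le hθ0.le hθ1 (ht i)) (hv i)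
          _ = δ := by rw [← Finset.mul_sum, ← hA, div_mul_cancel₀ _ hA1.ne']
      have h3 := hS (fun i => δ / A * t i) (fun i => mul_nonneg hθ0.le (ht i)) h2
      have h4 : ∑ i ∈ S, δ / A * t i * v i * β i = δ / A * ∑ i ∈ S, t i * v i * β i := by
        rw [Finset.mul_sum]
        exact Finset.sum_congr rfl fun i _ => by ring
      rw [h4, div_mul_eq_mul_div, div_le_iff₀ hA1] at h3
      have h5 := mul_le_mul_of_nonneg_left h3 hη
      have h6 := mul_le_mul_of_nonneg_right hηδ hA0
      have h7 : δ * (η * ∑ i ∈ S, t i * v i * β i) ≤ δ * A := by linarith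
      have := le_of_mul_le_mul_left h7 hδ
      linarith
  have hsup : ∀ i, complementary Ψ (η * β i) * ENNReal.ofReal (v i) =
      ⨆ t : Ici (0 : ℝ), ENNReal.ofReal (η * β i * t - Ψ t) * ENNReal.ofReal (v i) := by
    intro i
    rw [complementary, iSup_subtype', ENNReal.iSup_mul]
  simp_rw [hsup]
  refine sum_iSup_le fun t => ?_
  -- the terms with a negative value are removed by replacing `t i` by `0`
  set t' : ι → ℝ := fun i => if 0 ≤ η * β i * t i - Ψ (t i) then (t i : ℝ) else 0 with ht'
  have ht'0 : ∀ i, 0 ≤ t' i := fun i => by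
    simp only [ht']
    split_ifs
    · exact (t i).2
    · exact le_rfl
  have heq : ∀ i, max (η * β i * t i - Ψ (t i)) 0 = η * β i * t' i - Ψ (t' i) := by
    intro i
    simp only [ht']
    split_ifs with hc
    · exact max_eq_left hc
    · rw [max_eq_right (not_le.1 hc).le, h.map_zero, mul_zero, sub_zero]
  calc ∑ i ∈ S, ENNReal.ofReal (η * β i * t i - Ψ (t i)) * ENNReal.ofReal (v i)
      = ∑ i ∈ S, ENNReal.ofReal ((η * β i * t' i - Ψ (t' i)) * v i) := by
        refine Finset.sum_congr rfl fun i _ => ?_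
        rw [← heq, ENNReal.ofReal_mul (le_max_right _ _)]
        congr 1
        rw [ENNReal.ofReal_max, ENNReal.ofReal_zero, max_eq_left zero_le]
    _ = ENNReal.ofReal (∑ i ∈ S, (η * β i * t' i - Ψ (t' i)) * v i) := by
        rw [ENNReal.ofReal_sum_of_nonneg]
        intro i _
        rw [← heq]
        exact mul_nonneg (le_max_right _ _) (hv i)
    _ ≤ 1 := ENNReal.ofReal_le_one.2 (key t' ht'0)

lemma sFinite_of_measure_tile_lt_top {μ : Measure ℂ} (hμ : μ upperHalfPlaneSetᶜ = 0)
    (h : ∀ q, μ (tile q) < ∞) : SFinite μ := by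
  have h1 : μ = Measure.sum fun q => μ.restrict (tile q) := by
    rw [← Measure.restrict_iUnion pairwise_disjoint_tile measurableSet_tile, iUnion_tile,
      Measure.restrict_eq_self_of_ae_mem (s := upperHalfPlaneSet) (mem_ae_iff.2 hμ)]
  have h2 : ∀ q, IsFiniteMeasure (μ.restrict (tile q)) := fun q => ⟨by simpa using h q⟩
  rw [h1]
  infer_instance

theorem berezin_of_embedding {α : ℝ} (hα : -1 < α) {Φ₁ Φ₂ : ℝ → ℝ} (h₁ : IsYoungType Φ₁)
    (h₂ : ClassL Φ₂ ∨ ClassU Φ₂) (hmono : MonotoneOn (fun t => Φ₁ t / Φ₂ t) (Ioi 0))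
    {μ : Measure ℂ} (hμ : μ upperHalfPlaneSetᶜ = 0)
    (hemb : ∃ C : ℝ, 0 < C ∧ ∀ F ∈ bergmanOrlicz α Φ₁, MemOrlicz (toENN Φ₂) μ F ∧
      luxNorm (toENN Φ₂) μ F ≤ ENNReal.ofReal C * luxNorm (toENN Φ₁) (V α) F) :
    (∀ᵐ z ∂V α, berezin α μ z < ∞) ∧ MemOrlicz (complementary (Φ₁ ∘ inverse Φ₂)) (V α)
      (fun z => ((berezin α μ z).toReal : ℂ)) := by
  have hΨ := isYoungType_comp_inverse h₁ h₂ hmono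
  obtain ⟨δ₀, hδ₀, htile⟩ := exists_tile_bound hα h₁ h₂ hμ hemb
  obtain ⟨δ, C, hδ, hC, hsum⟩ := exists_sum_berezin_le hα hΨ hμ hδ₀ htile
  set Ψ := Φ₁ ∘ inverse Φ₂
  obtain ⟨D, hD, hcomp⟩ := exists_berezin_le hα hμ
  set v : ℤ × ℤ → ℝ := fun q => (V α (tile q)).toReal with hv
  have hv0 : ∀ q, 0 < v q := fun q => ENNReal.toReal_pos (V_tile_ne_zero α q) (V_tile_ne_top α q)
  have hvV : ∀ q, ENNReal.ofReal (v q) = V α (tile q) := fun q =>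
    ENNReal.ofReal_toReal (V_tile_ne_top α q)
  have hcorner : ∀ q, berezin α μ (corner q) ≠ ∞ := by
    intro q htop
    obtain ⟨t, ht, hΨt⟩ := hΨ.exists_pos_map_le (δ / v q) (div_pos hδ (hv0 q))
    have h3 := hsum {q} (fun _ => t) (fun _ => ht.le) (by
      rw [Finset.sum_singleton, ← hvV, ← ENNReal.ofReal_mul (hΨ.nonneg ht.le)]
      exact ENNReal.ofReal_le_ofReal ((le_div_iff₀ (hv0 q)).1 hΨt))
    rw [Finset.sum_singleton, htop, ENNReal.mul_top (mul_ne_zero (by simpa using ht)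
      (V_tile_ne_zero α q))] at h3
    exact ENNReal.ofReal_ne_top (top_le_iff.1 h3)
  have hfin : ∀ z ∈ upperHalfPlaneSet, berezin α μ z < ∞ := by
    intro z hz
    obtain ⟨q, hq⟩ := exists_mem_tile hz
    exact (hcomp q z hq _ (corner_mem_tile q)).trans_lt
      (ENNReal.mul_lt_top ENNReal.ofReal_lt_top (hcorner q).lt_top)
  refine ⟨(ae_V_mem α).mono fun z hz => hfin z hz, ?_, ?_⟩
  · obtain ⟨C', -, hμtile⟩ := exists_measure_tile_le hα μ
    have : SFinite μ := sFinite_of_measure_tile_lt_top hμ fun q =>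
      (hμtile q _ (corner_mem_tile q)).trans_lt (ENNReal.mul_lt_top
        (ENNReal.mul_lt_top ENNReal.ofReal_lt_top (V_tile_ne_top α q).lt_top)
        (hcorner q).lt_top)
    have hm : Measurable (berezin α μ) := by
      rw [funext (berezin_eq_lintegral_powKernel α μ)]
      exact Measurable.lintegral_prod_right' (f := fun p : ℂ × ℂ =>
        ENNReal.ofReal (powKernel α (2 * (2 + α)) 0 p.2 p.1))
        ((measurable_powKernel α _ 0).comp measurable_swap).ennreal_ofReal
    exact (Complex.measurable_ofReal.comp hm.ennreal_toReal).aestronglyMeasurable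
  · set β : ℤ × ℤ → ℝ := fun q => (berezin α μ (corner q)).toReal with hβ
    set η : ℝ := min δ 1 / C with hη
    have hη0 : 0 < η := div_pos (lt_min hδ one_pos) hC
    have hηC : η * C = min δ 1 := div_mul_cancel₀ _ hC.ne'
    have hS : ∀ S : Finset (ℤ × ℤ), ∑ q ∈ S, complementary Ψ (η * β q) * V α (tile q) ≤ 1 := by
      intro S
      simp_rw [← hvV]
      refine hΨ.sum_complementary_le (fun q => (hv0 q).le) hδ (fun t ht hle => ?_) hη0.le
        (hηC.trans_le (min_le_left _ _)) (hηC.trans_le (min_le_right _ _))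
      have h4 := hsum S t ht (by
        simp_rw [← hvV, ← ENNReal.ofReal_mul (hΨ.nonneg (ht _))]
        rw [← ENNReal.ofReal_sum_of_nonneg fun q _ =>
          mul_nonneg (hΨ.nonneg (ht q)) (hv0 q).le]
        exact ENNReal.ofReal_le_ofReal hle)
      have h5 : ∀ q, ENNReal.ofReal (t q) * V α (tile q) * berezin α μ (corner q) =
          ENNReal.ofReal (t q * v q * β q) := by
        intro q
        rw [ENNReal.ofReal_mul (mul_nonneg (ht q) (hv0 q).le), ENNReal.ofReal_mul (ht q), hvV,
          hβ, ENNReal.ofReal_toReal (hcorner q)]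
      simp_rw [h5] at h4
      rw [← ENNReal.ofReal_sum_of_nonneg fun q _ =>
        mul_nonneg (mul_nonneg (ht q) (hv0 q).le) ENNReal.toReal_nonneg] at h4
      exact (ENNReal.ofReal_le_ofReal_iff hC.le).1 h4
    refine (luxNorm_le (r := D / η) (by positivity) ?_).trans_lt ENNReal.ofReal_lt_top
    rw [lintegral_eq_tsum_tile (V_compl α)]
    calc ∑' q, ∫⁻ z in tile q,
          complementary Ψ (‖((berezin α μ z).toReal : ℂ)‖ / (D / η)) ∂V α
        ≤ ∑' q, complementary Ψ (η * β q) * V α (tile q) := by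
          refine ENNReal.tsum_le_tsum fun q => ?_
          rw [← setLIntegral_const]
          refine setLIntegral_mono' (measurableSet_tile q) fun z hz => complementary_mono ?_
          have h6 : (berezin α μ z).toReal ≤ D * β q := by
            have h7 := ENNReal.toReal_mono
              (ENNReal.mul_ne_top ENNReal.ofReal_ne_top (hcorner q))
              (hcomp q z hz _ (corner_mem_tile q))
            rwa [ENNReal.toReal_mul, ENNReal.toReal_ofReal hD.le] at h7
          rw [Complex.norm_real, Real.norm_of_nonneg ENNReal.toReal_nonneg, div_div_eq_mul_div,
            div_le_iff₀ hD]
          nlinarith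
      _ ≤ 1 := by
          rw [ENNReal.tsum_eq_iSup_sum]
          exact iSup_le hS

end BergmanOrlicz

open BergmanOrlicz in
theorem theorem2 (α : ℝ) (hα : -1 < α) (Φ₁ Φ₂ : ℝ → ℝ)
    (hΦ₁ : ClassU Φ₁) (hΦ₁' : Nabla2 Φ₁) (hΦ₂ : ClassL Φ₂ ∨ ClassU Φ₂)
    -- a positive Borel measure on the upper half-plane
    (μ : Measure ℂ) (hμ : μ upperHalfPlaneSetᶜ = 0)
    (hmono : MonotoneOn (fun t => Φ₁ t / Φ₂ t) (Ioi 0))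
    (hint : ∃ C : ℝ, 0 < C ∧ ∀ t : ℝ, 0 < t →
      ∫⁻ s in Ioo 0 t, ENNReal.ofReal ((Φ₁ ∘ inverse Φ₂) s / s ^ 2) ≤
        ENNReal.ofReal (C * ((Φ₁ ∘ inverse Φ₂) t / t))) :
    -- continuous embedding of `A^{Φ₁}_α(ℂ₊)` into `L^{Φ₂}(ℂ₊, dμ)`
    (∃ C : ℝ, 0 < C ∧ ∀ F ∈ bergmanOrlicz α Φ₁,
      MemOrlicz (toENN Φ₂) μ F ∧
        luxNorm (toENN Φ₂) μ F ≤ ENNReal.ofReal C * luxNorm (toENN Φ₁) (V α) F) ↔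
    -- the Berezin transform is (a.e. finite and) in `L^{Φ₃}(ℂ₊, dV_α)`
    ((∀ᵐ z ∂V α, berezin α μ z < ∞) ∧
      MemOrlicz (complementary (Φ₁ ∘ inverse Φ₂)) (V α)
        (fun z => ((berezin α μ z).toReal : ℂ))) := by
  have h₁ := hΦ₁.isYoungType
  exact ⟨berezin_of_embedding hα h₁ hΦ₂ hmono hμ, fun h =>
    embedding_of_berezin hα h₁ hΦ₂ hμ h.1 h.2.2⟩
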